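/- Let $k$ be a field, let $\pi\colon X\to\operatorname{Spec} k$ be a proper scheme, and set $A=\mathrm{H}^0(X,\mathcal{O}_X)$, $S=\operatorname{Spec} A$, with $\rho\colon S\to\operatorname{Spec} k$ the morphism induced by $\pi$. Let $\mathcal{K}^M_{1,X}$ be the degree-one Milnor $K$-theory sheaf on the big Zariski site of $X$, i.e. the Zariski sheaf associated with $Y\mapsto K^M_1(\Gamma(Y,\mathcal{O}_Y))$, where $K^M_n(R)$ is the degree-$n$ part of the quotient of the tensor algebra over $\mathbb{Z}$ of $R^\times$ by the two-sided ideal generated by the elements $a\otimes b$ with $a,b\in R^\times$, $a+b=1$ (thus $K^M_1(R)=R^\times$). Let $\pi_*\mathcal{K}^M_{1,X}$ be the functor $T\mapsto \mathcal{K}^M_{1,X}(X\times_k T)$ from $k$-schemes to abelian groups. Then the Weil restriction $\operatorname{Res}_{S/k}(\mathbb{G}_{m,S})$ exists as a group $k$-scheme, that is, the group-valued functor $T\mapsto\operatorname{Hom}_S(T\times_k S,\mathbb{G}_{m,S})$ on all $k$-schemes is represented by a group $k$-scheme, and this group scheme represents the group-valued functor $\pi_*\mathcal{K}^M_{1,X}$: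 there are group isomorphisms $$\operatorname{Hom}_k\bigl(T,\operatorname{Res}_{S/k}(\mathbb{G}_{m,S})\bigr)\;\cong\;(\pi_*\mathcal{K}^M_{1,X})(T),$$ natural in the $k$-scheme $T$. -/

import Mathlib

open CategoryTheory AlgebraicGeometry Opposite
open scoped TensorProduct LaurentPolynomial

universe w v u

noncomputable section

/-! ### Milnor K-theory of commutative rings -/

/-- The degree `n` part of the two-sided ideal of the tensor algebra `⨁ₙ (Rˣ)^{⊗ n}` (over `ℤ`)
generated by the Steinberg relations `a ⊗ b` with `a, b ∈ Rˣ` and `a + b = 1`. -/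
def steinbergRelations (n : ℕ) (R : Type u) [CommRing R] :
    Submodule ℤ (⨂[ℤ] _ : Fin n, Additive Rˣ) :=
  Submodule.span ℤ {x | ∃ (a : Fin n → Rˣ) (i j : Fin n), (i : ℕ) + 1 = j ∧
    (a i : R) + (a j : R) = 1 ∧ x = PiTensorProduct.tprod ℤ fun l ↦ Additive.ofMul (a l)}

/-- The `n`-th Milnor K-group of a commutative ring, written additively. -/
abbrev MilnorK (n : ℕ) (R : Type u) [CommRing R] : Type u :=
  (⨂[ℤ] _ : Fin n, Additive Rˣ) ⧸ steinbergRelations n R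

/-- The map induced on `n`-fold tensor powers of unit groups by a ring homomorphism. -/
def unitsTensorMap (n : ℕ) {R S : Type u} [CommRing R] [CommRing S] (f : R →+* S) :
    (⨂[ℤ] _ : Fin n, Additive Rˣ) →ₗ[ℤ] (⨂[ℤ] _ : Fin n, Additive Sˣ) :=
  PiTensorProduct.map fun _ ↦
    (MonoidHom.toAdditive (Units.map (f : R →* S))).toIntLinearMap

lemma steinbergRelations_le_comap (n : ℕ) {R S : Type u} [CommRing R] [CommRing S]
    (f : R →+* S) :
    steinbergRelations n R ≤ (steinbergRelations n S).comap (unitsTensorMap n f) := by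
  refine Submodule.span_le.2 ?_
  rintro _ ⟨a, i, j, hij, h, rfl⟩
  refine Submodule.subset_span ⟨fun l ↦ Units.map (f : R →* S) (a l), i, j, hij, ?_, ?_⟩
  · simpa using congrArg f h
  · simp [unitsTensorMap]

/-- The functoriality `{a₁, …, aₙ} ↦ {f a₁, …, f aₙ}` of Milnor K-groups. -/
def MilnorK.map (n : ℕ) {R S : Type u} [CommRing R] [CommRing S] (f : R →+* S) :
    MilnorK n R →ₗ[ℤ] MilnorK n S :=
  Submodule.mapQ _ _ (unitsTensorMap n f) (steinbergRelations_le_comap n f)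

/-- Milnor K-theory in degree `n` as a functor on commutative rings. -/
def milnorKFunctor (n : ℕ) : CommRingCat.{u} ⥤ AddCommGrpCat.{u} where
  obj R := AddCommGrpCat.of (MilnorK n R)
  map f := AddCommGrpCat.ofHom (MilnorK.map n f.hom).toAddMonoidHom
  map_id R := by
    ext x
    obtain ⟨x, rfl⟩ := Submodule.Quotient.mk_surjective _ x
    induction x using PiTensorProduct.induction_on with
    | smul_tprod r a => simp [MilnorK.map, unitsTensorMap]
    | add x y hx hy => simp only [Submodule.Quotient.mk_add, map_add, hx, hy]
  map_comp f g := by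
    ext x
    obtain ⟨x, rfl⟩ := Submodule.Quotient.mk_surjective _ x
    induction x using PiTensorProduct.induction_on with
    | smul_tprod r a => simp [MilnorK.map, unitsTensorMap]; rfl
    | add x y hx hy => simp only [Submodule.Quotient.mk_add, map_add, hx, hy]

/-! ### The Milnor K-theory sheaf on the big Zariski site -/

/-- The presheaf `Y ↦ K^M_n(Γ(Y, 𝒪_Y))` on the category of `X`-schemes. -/
def milnorKPresheaf (n : ℕ) (X : Scheme.{u}) : (Over X)ᵒᵖ ⥤ AddCommGrpCat.{u + 1} :=
  (Over.forget X).op ⋙ Scheme.Γ ⋙ milnorKFunctor n ⋙ AddCommGrpCat.uliftFunctor.{u + 1, u}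

/-- The `n`-th Milnor K-theory sheaf `𝒦^M_{n,X}`: the sheaf associated with `milnorKPresheaf n X`
on the big Zariski site of `X`. -/
def milnorKSheaf (n : ℕ) (X : Scheme.{u}) :
    Sheaf (Scheme.zariskiTopology.{u}.over X) AddCommGrpCat.{u + 1} :=
  (presheafToSheaf _ _).obj (milnorKPresheaf n X)

/-- The pushforward `π_* F : T ↦ F(X ×_Y T)` of an abelian sheaf on the big Zariski site of `X`,
as a functor on `Y`-schemes with values in (multiplicatively written) groups. -/
def bigPushforward {X Y : Scheme.{u}} (π : X ⟶ Y)
    (F : Sheaf (Scheme.zariskiTopology.{u}.over X) AddCommGrpCat.{u + 1}) :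
    (Over Y)ᵒᵖ ⥤ GrpCat.{u + 1} :=
  (Over.pullback π).op ⋙ F.obj ⋙ AddCommGrpCat.toCommGrp ⋙ forget₂ CommGrpCat GrpCat

/-! ### Representability and Weil restriction -/

/-- The group object `G` represents the group-valued functor `F`: there are group isomorphisms
`Hom(T, G) ≃ F(T)`, natural in `T`. -/
def Represents {C : Type w} [Category.{v} C] [CartesianMonoidalCategory C]
    (G : Grp C) (F : Cᵒᵖ ⥤ GrpCat.{u}) : Prop :=
  ∃ e : ∀ T : Cᵒᵖ, (yonedaGrp.obj G).obj T ≃* F.obj T,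
    ∀ ⦃T T' : Cᵒᵖ⦄ (f : T ⟶ T') (x : (yonedaGrp.obj G).obj T),
      F.map f (e T x) = e T' ((yonedaGrp.obj G).map f x)

/-- `R` is the Weil restriction along `ρ : S ⟶ Y` of the group `S`-scheme `G`:
it represents the group functor `T ↦ Hom_S(T ×_Y S, G)` on `Y`-schemes. -/
def IsWeilRestriction {S Y : Scheme.{u}} (ρ : S ⟶ Y) (G : Grp (Over S)) (R : Grp (Over Y)) :
    Prop :=
  Represents R ((Over.pullback ρ).op ⋙ yonedaGrp.obj G)

/-- The multiplicative group `𝔾_m = Spec A[T, T⁻¹]` over `Spec A`, with the group structure given by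
the comultiplication `T ↦ T ⊗ T`. -/
def multiplicativeGroup (A : CommRingCat.{u}) : Grp (Over (Spec A)) :=
  (hopfSpec A).obj (op (CommHopfAlgCat.of A A[T;T⁻¹]))

/-- For a morphism `π : X ⟶ Spec k`, the induced morphism `Spec H⁰(X, 𝒪_X) ⟶ Spec k`. -/
def specGlobalSections {X : Scheme.{u}} {k : CommRingCat.{u}} (π : X ⟶ Spec k) :
    Spec Γ(X, ⊤) ⟶ Spec k :=
  Spec.map ((Scheme.ΓSpecIso k).inv ≫ π.appTop)

end

noncomputable section

/-! ### Functions with bounded poles on a complete model of a function field -/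

/-! In degree one there are no Steinberg relations, so `K^M_1` is the presheaf of units, which is
already a Zariski sheaf. Hence the direct image sends `T` to the units of `Γ(T ×_k X, 𝒪)`, while
`T`-points of the Weil restriction are the units of `Γ(T ×_k S, 𝒪)` (`multiplicativeGroupEquiv`).
Over a field every `T` is flat, so for affine `T` flat base change writes both rings as the base
change of `A`; Zariski gluing extends this to all `T` (`bijective_pullbackSectionsMap`).

For existence, `A` must be finite over `k`. Then an element of `B ⊗ A` is a tuple of coordinates,
and a unit together with its inverse is a solution of polynomial equations in the coordinates of
both: an affine scheme represents the units (`bijective_universalUnit`).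

Finiteness of `A` is proved by valuations, without coherent cohomology. Over a perfect field, global
functions are detected in finitely many quotients `𝒪_x / 𝔪_x ^ n`. On each step `𝔪 ^ n / 𝔪 ^ (n +
1)` their coordinates are elements of `κ(x)` with bounded poles on an affine cover, and by the
valuative criterion every valuation ring of `κ(x)` over `k` contains the functions of some chart
through `x`. Traces to a rational function field `k(t)` then have a fixed denominator and bounded
degree, and nondegeneracy of the trace form bounds the dimension
(`finiteDimensional_of_boundedPoles`). A general field is reached by faithfully flat descent from
its algebraic closure. -/

/-- If every valuation subring containing `R` contains some `A i`, then elements with poles bounded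
by the `g i` have a common denominator with respect to the integral closure of `R`. -/
theorem exists_common_denominator_isIntegral {R K ι : Type*} [CommRing R] [IsDomain R] [Field K]
    [Algebra R K] [Algebra.IsAlgebraic R K] [Finite ι] (A : ι → Subring K) (g : ι → K)
    (hg : ∀ i, g i ≠ 0)
    (hV : ∀ V : ValuationSubring K, (∀ r : R, algebraMap R K r ∈ V) → ∃ i, A i ≤ V.toSubring) :
    ∃ h : R, h ≠ 0 ∧ ∀ f : K, (∀ i, g i * f ∈ A i) → IsIntegral R (h • f) := by
  cases nonempty_fintype ι
  classical
  choose h h0 hint using fun i ↦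
    (Algebra.IsAlgebraic.isAlgebraic (R := R) (g i)⁻¹).exists_integral_multiple
  -- The integral closure of a subring of a field is the intersection of the valuation rings
  -- containing it.
  have key {x : K} (hx : ∀ V : ValuationSubring K, (∀ r : R, algebraMap R K r ∈ V) → x ∈ V) :
      IsIntegral R x := by
    have h1 : x ∈ (⨅ V : {V : ValuationSubring K //
        Set.range (algebraMap R K) ⊆ V.toSubring}, V.1.toSubring) := by
      rw [Subring.mem_iInf]
      intro V
      exact hx V.1 fun r ↦ V.2 ⟨r, rfl⟩
    rw [iInf_valuationSubring_superset] at h1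
    have hcl : Subring.closure (Set.range (algebraMap R K)) = (algebraMap R K).range := by
      rw [← RingHom.coe_range, Subring.closure_eq]
    rw [hcl] at h1
    let _ : Algebra R (algebraMap R K).range := (algebraMap R K).rangeRestrict.toAlgebra
    have : IsScalarTower R (algebraMap R K).range K := .of_algebraMap_eq fun _ ↦ rfl
    have : Algebra.IsIntegral R (algebraMap R K).range :=
      Algebra.isIntegral_of_surjective (algebraMap R K).rangeRestrict_surjective
    exact isIntegral_trans x h1
  refine ⟨∏ i, h i, Finset.prod_ne_zero_iff.2 fun i _ ↦ h0 i, fun f hf ↦ key fun V hRV ↦ ?_⟩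
  obtain ⟨i, hi⟩ := hV V hRV
  have h1 : h i • (g i)⁻¹ ∈ V := by
    let _ : Algebra R V := ((algebraMap R K).codRestrict V hRV).toAlgebra
    have : IsScalarTower R V K := .of_algebraMap_eq fun _ ↦ rfl
    obtain ⟨y, hy⟩ := IsIntegrallyClosed.isIntegral_iff.1 ((hint i).tower_top (A := V))
    exact hy ▸ y.2
  -- For the chart `i` belonging to `V`, all three factors lie in `V`: a scalar from `R`, the
  -- integral element `h i • (g i)⁻¹`, and `g i * f ∈ A i`.
  have : (∏ j, h j) • f =
      algebraMap R K (∏ j ∈ Finset.univ.erase i, h j) * (h i • (g i)⁻¹) * (g i * f) := by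
    rw [← Finset.mul_prod_erase _ _ (Finset.mem_univ i)]
    simp only [Algebra.smul_def, map_mul]
    field_simp [hg i]
  rw [this]
  exact mul_mem (mul_mem (hRV _) h1) (hi (hf i))

/-- The trace of an integral element is integral over `R`, hence in `R` because `R` is integrally
closed; the common denominator passes through the trace by linearity. -/
theorem exists_smul_trace_mem_range {R F K ι : Type*} [CommRing R] [IsDomain R]
    [IsIntegrallyClosed R] [Field F] [Field K] [Algebra R F] [IsFractionRing R F] [Algebra F K]
    [Algebra R K] [IsScalarTower R F K] [FiniteDimensional F K] [Finite ι]
    (A : ι → Subring K) (g : ι → K) (hg : ∀ i, g i ≠ 0)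
    (hV : ∀ V : ValuationSubring K, (∀ r : R, algebraMap R K r ∈ V) → ∃ i, A i ≤ V.toSubring) :
    ∃ h : R, h ≠ 0 ∧ ∀ f : K, (∀ i, g i * f ∈ A i) →
      ∃ r : R, algebraMap R F r = algebraMap R F h * Algebra.trace F K f := by
  have : Algebra.IsAlgebraic R K :=
    (IsFractionRing.comap_isAlgebraic_iff (A := R) (K := F) (C := K)).2 inferInstance
  obtain ⟨h, h0, hint⟩ := exists_common_denominator_isIntegral (R := R) A g hg hV
  refine ⟨h, h0, fun f hf ↦ ?_⟩
  have h1 : IsIntegral R (Algebra.trace F K (h • f)) := Algebra.isIntegral_trace (hint f hf)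
  obtain ⟨r, hr⟩ := IsIntegrallyClosed.isIntegral_iff.1 h1
  refine ⟨r, hr.trans ?_⟩
  rw [algebra_compatible_smul F h f, map_smul, smul_eq_mul]

section Degree

variable {σ k F : Type*} [Field k] [Field F] [Algebra (MvPolynomial σ k) F]
  [IsFractionRing (MvPolynomial σ k) F]

variable (σ k F) in
/-- The valuation ring of rational functions of total degree at most zero. -/
def degreeValuationSubring : ValuationSubring F where
  carrier := {y | ∃ a b : MvPolynomial σ k, b ≠ 0 ∧ a.totalDegree ≤ b.totalDegree ∧
    y * algebraMap _ F b = algebraMap _ F a}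
  mul_mem' := by
    rintro x y ⟨a, b, hb, hab, h⟩ ⟨c, d, hd, hcd, h'⟩
    refine ⟨a * c, b * d, mul_ne_zero hb hd, ?_, ?_⟩
    · rw [MvPolynomial.totalDegree_mul_of_isDomain hb hd]
      exact (MvPolynomial.totalDegree_mul _ _).trans (add_le_add hab hcd)
    · rw [map_mul, map_mul, ← h, ← h']; ring
  one_mem' := ⟨1, 1, one_ne_zero, le_rfl, by simp⟩
  add_mem' := by
    rintro x y ⟨a, b, hb, hab, h⟩ ⟨c, d, hd, hcd, h'⟩
    refine ⟨a * d + c * b, b * d, mul_ne_zero hb hd, ?_, ?_⟩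
    · rw [MvPolynomial.totalDegree_mul_of_isDomain hb hd]
      refine (MvPolynomial.totalDegree_add _ _).trans (max_le ?_ ?_) <;>
      · refine (MvPolynomial.totalDegree_mul _ _).trans ?_
        omega
    · rw [map_add, map_mul, map_mul, map_mul, ← h, ← h']; ring
  zero_mem' := ⟨0, 1, one_ne_zero, by simp, by simp⟩
  neg_mem' := by
    rintro x ⟨a, b, hb, hab, h⟩
    exact ⟨-a, b, hb, by simpa using hab, by simp [← h]⟩
  mem_or_inv_mem' := by
    intro x
    obtain ⟨a, b, hb, rfl⟩ := IsFractionRing.div_surjective (A := MvPolynomial σ k) x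
    have hb' : algebraMap _ F b ≠ 0 :=
      IsFractionRing.to_map_ne_zero_of_mem_nonZeroDivisors hb
    by_cases ha : a = 0
    · exact .inl ⟨0, 1, one_ne_zero, by simp, by simp [ha]⟩
    have ha' : algebraMap _ F a ≠ 0 :=
      IsFractionRing.to_map_ne_zero_of_mem_nonZeroDivisors (mem_nonZeroDivisors_of_ne_zero ha)
    rcases le_total a.totalDegree b.totalDegree with h | h
    · exact .inl ⟨a, b, nonZeroDivisors.ne_zero hb, h, by field_simp⟩
    · exact .inr ⟨b, a, ha, h, by field_simp⟩

/-- Polynomials with bounded pole at infinity have bounded degree. -/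
theorem exists_totalDegree_le (h : F) (h0 : h ≠ 0) :
    ∃ N : ℕ, ∀ p : MvPolynomial σ k, h * algebraMap _ F p ∈ degreeValuationSubring σ k F →
      p.totalDegree ≤ N := by
  obtain ⟨a, b, hb, rfl⟩ := IsFractionRing.div_surjective (A := MvPolynomial σ k) h
  have inj := IsFractionRing.injective (MvPolynomial σ k) F
  have hb0 := nonZeroDivisors.ne_zero hb
  have hb' : algebraMap _ F b ≠ 0 := (map_ne_zero_iff _ inj).2 hb0
  have ha : a ≠ 0 := by rintro rfl; simp at h0
  -- With `h = a / b` and `h * p = c / d`, the identity `a * p * d = c * b` and `deg c ≤ deg d` give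
  -- `deg p ≤ deg b`.
  refine ⟨b.totalDegree, fun p ⟨c, d, hd, hcd, e⟩ ↦ ?_⟩
  by_cases hp : p = 0
  · simp [hp]
  have e' : a * p * d = c * b := by
    apply inj
    rw [map_mul, map_mul, map_mul, ← e]
    field_simp
  have hc : c ≠ 0 := by
    rintro rfl
    simp [ha, hp, hd] at e'
  have := congr(MvPolynomial.totalDegree $e')
  rw [MvPolynomial.totalDegree_mul_of_isDomain (mul_ne_zero ha hp) hd,
    MvPolynomial.totalDegree_mul_of_isDomain ha hp,
    MvPolynomial.totalDegree_mul_of_isDomain hc hb0] at this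
  omega

end Degree

/-- The denominator bound is used twice. Over the polynomial ring it writes the trace as `p / h₁`;
over the degree valuation ring it bounds the pole of `p / h₁` at infinity by `h₂`. Together they
bound the degree of `p`. -/
theorem exists_finiteDimensional_trace_mem {k F K ι : Type*} (σ : Type*) [Field k] [Field F] [Field K]
    [Algebra (MvPolynomial σ k) F] [IsFractionRing (MvPolynomial σ k) F] [Algebra F K]
    [FiniteDimensional F K] [Algebra k F] [Algebra k K] [IsScalarTower k F K]
    [IsScalarTower k (MvPolynomial σ k) F] [Finite σ] [Finite ι]
    (A : ι → Subring K) (g : ι → K) (hg : ∀ i, g i ≠ 0)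
    (hV : ∀ V : ValuationSubring K, (∀ r : k, algebraMap k K r ∈ V) → ∃ i, A i ≤ V.toSubring) :
    ∃ N : Submodule k F, FiniteDimensional k N ∧
      ∀ f : K, (∀ i, g i * f ∈ A i) → Algebra.trace F K f ∈ N := by
  let _ : Algebra (MvPolynomial σ k) K :=
    ((algebraMap F K).comp (algebraMap (MvPolynomial σ k) F)).toAlgebra
  have : IsScalarTower (MvPolynomial σ k) F K := .of_algebraMap_eq fun _ ↦ rfl
  have hk (c : k) : algebraMap k K c = algebraMap F K (algebraMap (MvPolynomial σ k) F (.C c)) := by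
    rw [IsScalarTower.algebraMap_apply k F K, IsScalarTower.algebraMap_apply k (MvPolynomial σ k) F]
    rfl
  obtain ⟨h₁, h₁0, H₁⟩ := exists_smul_trace_mem_range (R := MvPolynomial σ k) (F := F) A g hg
    fun V hV' ↦ hV V fun r ↦ (hk r ▸ hV' (.C r) :)
  obtain ⟨h₂, h₂0, H₂⟩ := exists_smul_trace_mem_range (R := degreeValuationSubring σ k F)
    (F := F) A g hg fun V hV' ↦ hV V fun r ↦ by
      rw [hk]
      exact hV' ⟨algebraMap _ F (MvPolynomial.C r), MvPolynomial.C r, 1, one_ne_zero, by simp, by simp⟩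
  have inj := IsFractionRing.injective (MvPolynomial σ k) F
  have h₁0' : algebraMap _ F h₁ ≠ 0 := (map_ne_zero_iff _ inj).2 h₁0
  obtain ⟨N, hN⟩ := exists_totalDegree_le (σ := σ) (k := k) (F := F) (h₂.1 / algebraMap _ F h₁)
    (div_ne_zero (by simpa using h₂0) h₁0')
  let φ : MvPolynomial σ k →ₗ[k] F :=
    (LinearMap.mulLeft k (algebraMap _ F h₁)⁻¹).comp (Algebra.linearMap _ F |>.restrictScalars k)
  refine ⟨(MvPolynomial.restrictTotalDegree σ k N).map φ, inferInstance, fun f hf ↦ ?_⟩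
  obtain ⟨p, hp⟩ := H₁ f hf
  obtain ⟨r, hr⟩ := H₂ f hf
  refine ⟨p, (MvPolynomial.mem_restrictTotalDegree _ _ _).2 (hN p ?_), ?_⟩
  · rw [hp]
    have : h₂.1 / algebraMap _ F h₁ * (algebraMap _ F h₁ * Algebra.trace F K f) = r.1 := by
      field_simp
      exact hr.symm
    rw [this]
    exact r.2
  · simp [φ, hp, h₁0']

/-- For a basis `b` of `K` over `F`, nondegeneracy of the trace form makes `f` determined by the
traces of `b l * f`, and `b l * f` has poles bounded by `g i / b l`. -/
theorem finiteDimensional_of_boundedPoles_of_separable {k F K ι : Type*} (σ : Type*) [Field k] [Field F] [Field K]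
    [Algebra (MvPolynomial σ k) F] [IsFractionRing (MvPolynomial σ k) F] [Algebra F K]
    [FiniteDimensional F K] [Algebra k F] [Algebra k K] [IsScalarTower k F K]
    [IsScalarTower k (MvPolynomial σ k) F] [Finite σ] [Finite ι] [Algebra.IsSeparable F K]
    (A : ι → Subring K) (g : ι → K) (hg : ∀ i, g i ≠ 0)
    (hV : ∀ V : ValuationSubring K, (∀ r : k, algebraMap k K r ∈ V) → ∃ i, A i ≤ V.toSubring)
    (M : Submodule k K) (hM : ∀ f ∈ M, ∀ i, g i * f ∈ A i) : FiniteDimensional k M := by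
  let b := Module.finBasis F K
  choose N hN hN' using fun l ↦ exists_finiteDimensional_trace_mem σ (k := k) (F := F) A
    (fun i ↦ g i / b l) (fun i ↦ div_ne_zero (hg i) (b.ne_zero l)) hV
  let φ : M →ₗ[k] ∀ l, N l := LinearMap.pi fun l ↦
    (((Algebra.trace F K).restrictScalars k ∘ₗ LinearMap.mulLeft k (b l)) ∘ₗ M.subtype).codRestrict
      (N l) fun f ↦ hN' l _ fun i ↦ by
        have := hM f f.2 i
        convert! this using 1
        have := b.ne_zero l
        simp
        field_simp
  refine FiniteDimensional.of_injective φ ((injective_iff_map_eq_zero _).2 fun f hf ↦ ?_)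
  have h (l) : Algebra.trace F K (b l * f) = 0 := congr_arg Subtype.val (congr_fun hf l)
  refine Subtype.ext ((traceForm_nondegenerate F K).2 _ fun x ↦ ?_)
  have : (Algebra.traceForm F K).flip f.1 = 0 := b.ext fun l ↦ by
    simpa [Algebra.traceForm_apply] using h l
  exact congr($this x)

/-- Let `K` be a finitely generated field extension of a perfect field `k` and let `A i` be finitely
many subrings such that every valuation ring of `K` over `k` contains one of them. Then the space of
`f` with `g i * f ∈ A i` is finite dimensional over `k`. -/
theorem finiteDimensional_of_boundedPoles {k K ι : Type*} [Field k] [PerfectField k] [Field K]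
    [Algebra k K] [Algebra.EssFiniteType k K] [Finite ι] (A : ι → Subring K) (g : ι → K)
    (hg : ∀ i, g i ≠ 0)
    (hV : ∀ V : ValuationSubring K, (∀ r : k, algebraMap k K r ∈ V) → ∃ i, A i ≤ V.toSubring)
    (M : Submodule k K) (hM : ∀ f ∈ M, ∀ i, g i * f ∈ A i) : FiniteDimensional k M := by
  -- Perfectness supplies a separating transcendence basis; `F` is the rational function field it
  -- generates, over which `K` is finite.
  obtain ⟨s, hs, hsep⟩ := exists_isTranscendenceBasis_and_isSeparable_of_perfectField k K
  have hr : Set.range ((↑) : s → K) = s := by simp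
  rw [← hr] at hsep
  let F := IntermediateField.adjoin k (Set.range ((↑) : s → K))
  let e := hs.1.aevalEquivField
  let _ : Algebra (MvPolynomial s k) F :=
    ((e : _ →+* F).comp (algebraMap _ (FractionRing (MvPolynomial s k)))).toAlgebra
  have : IsFractionRing (MvPolynomial s k) F :=
    IsLocalization.isLocalization_of_algEquiv _
      (AlgEquiv.ofRingEquiv (f := e.toRingEquiv) fun _ ↦ rfl :
        FractionRing (MvPolynomial s k) ≃ₐ[MvPolynomial s k] F)
  have : IsScalarTower k (MvPolynomial s k) F := .of_algebraMap_eq fun x ↦ by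
    rw [RingHom.algebraMap_toAlgebra, RingHom.comp_apply, ← IsScalarTower.algebraMap_apply]
    exact (e.commutes x).symm
  have : Algebra.EssFiniteType F K := .of_comp k F K
  have : FiniteDimensional F K := Algebra.finite_of_essFiniteType_of_isAlgebraic
  exact finiteDimensional_of_boundedPoles_of_separable (F := F) s A g hg hV M hM
end

noncomputable section

/-! ### Global functions modulo powers of a maximal ideal -/

open IsLocalRing

section LocalPart

variable {k A O ι : Type*} [Field k] [PerfectField k] [CommRing A] [Algebra k A] [CommRing O]
  [IsLocalRing O] [Algebra A O] [Algebra k O] [IsScalarTower k A O]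
  [Algebra.EssFiniteType k (ResidueField O)] [Finite ι] {B : ι → Type*} [∀ i, CommRing (B i)]
  [∀ i, IsNoetherianRing (B i)] (α : ∀ i, A →+* B i) (β : ∀ i, B i →+* O)
  (hαβ : ∀ i a, β i (α i a) = algebraMap A O a)
  (hfrac : ∀ i (y : O), ∃ b s : B i, β i s ∉ maximalIdeal O ∧ y * β i s = β i b)
  (hV : ∀ V : ValuationSubring (ResidueField O),
    (∀ r : k, algebraMap k (ResidueField O) r ∈ V) → ∃ i, ((residue O).comp (β i)).range ≤ V.toSubring)

omit [Algebra k A] [IsScalarTower k A O] in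
include hαβ hfrac hV in
/-- A linear functional on an ideal of a local ring of a complete model takes a finite dimensional
space of values on global functions. -/
theorem finiteDimensional_map_of_linearMap_residueField (F : Ideal O) (Φ : F →ₗ[O] ResidueField O)
    (M : Submodule k (ResidueField O))
    (hM : ∀ m ∈ M, ∃ (a : A) (ha : algebraMap A O a ∈ F), Φ ⟨algebraMap A O a, ha⟩ = m) :
    FiniteDimensional k M := by
  -- The preimage of `F` in `B i` is finitely generated, so a product of denominators of the values
  -- of `Φ` at the generators clears all values on it.
  have key (i) : ∃ g : ResidueField O, g ≠ 0 ∧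
      ∀ b (hb : β i b ∈ F), g * Φ ⟨β i b, hb⟩ ∈ ((residue O).comp (β i)).range := by
    obtain ⟨s, hs⟩ := IsNoetherian.noetherian (F.comap (β i))
    have hsF : ∀ c ∈ s, β i c ∈ F := fun c hc ↦ by
      have : c ∈ F.comap (β i) := hs ▸ Submodule.subset_span hc
      exact this
    have frac (y : ResidueField O) : ∃ t : B i, residue O (β i t) ≠ 0 ∧
        residue O (β i t) * y ∈ ((residue O).comp (β i)).range := by
      obtain ⟨y, rfl⟩ := residue_surjective y
      obtain ⟨b, t, ht, h⟩ := hfrac i y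
      exact ⟨t, by simpa using ht, b, by rw [mul_comm, ← map_mul, h]; rfl⟩
    choose t ht0 ht using fun c : s ↦ frac (Φ ⟨β i c, hsF c c.2⟩)
    refine ⟨∏ c, residue O (β i (t c)), Finset.prod_ne_zero_iff.2 fun c _ ↦ ht0 c, fun b hb ↦ ?_⟩
    have hb' : b ∈ Submodule.span (B i) (s : Set (B i)) := by rw [hs]; exact hb
    induction hb' using Submodule.span_induction with
    | mem c hc =>
      classical
      rw [← Finset.mul_prod_erase _ _ (Finset.mem_univ ⟨c, hc⟩), mul_right_comm]
      exact mul_mem (ht ⟨c, hc⟩) (prod_mem fun c _ ↦ ⟨t c, rfl⟩)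
    | zero =>
      have : (⟨β i 0, hb⟩ : F) = 0 := Subtype.ext (map_zero _)
      rw [this, map_zero, mul_zero]
      exact zero_mem _
    | add x y hx hy hx' hy' =>
      have hxF : β i x ∈ F := (hs ▸ hx : x ∈ F.comap (β i))
      have hyF : β i y ∈ F := (hs ▸ hy : y ∈ F.comap (β i))
      have : (⟨β i (x + y), hb⟩ : F) = ⟨β i x, hxF⟩ + ⟨β i y, hyF⟩ := Subtype.ext (map_add _ _ _)
      rw [this, map_add, mul_add]
      exact add_mem (hx' hxF) (hy' hyF)
    | smul r x hx hx' =>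
      have hxF : β i x ∈ F := (hs ▸ hx : x ∈ F.comap (β i))
      have : (⟨β i (r • x), hb⟩ : F) = β i r • ⟨β i x, hxF⟩ := Subtype.ext (map_mul _ _ _)
      rw [this, map_smul, Algebra.smul_def, mul_left_comm]
      exact mul_mem ⟨r, rfl⟩ (hx' hxF)
  choose g hg0 hg using key
  refine finiteDimensional_of_boundedPoles (fun i ↦ ((residue O).comp (β i)).range) g hg0 hV M ?_
  intro m hm i
  obtain ⟨a, ha, rfl⟩ := hM m hm
  have := hg i (α i a) (by rwa [hαβ])
  simpa only [hαβ] using this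

/-- Coordinates on `F / 𝔪 F` for a finitely generated ideal `F` of a local ring. -/
theorem exists_linearMap_residueField_of_fg (F : Ideal O) (hF : F.FG) :
    ∃ (n : ℕ) (Φ : Fin n → F →ₗ[O] ResidueField O),
      ∀ f : F, (∀ l, Φ l f = 0) → (f : O) ∈ maximalIdeal O * F := by
  have : Module.Finite O F := Module.Finite.iff_fg.2 hF
  let b := Module.finBasis (ResidueField O) (ResidueField O ⊗[O] F)
  refine ⟨_, fun l ↦ ((b.coord l).restrictScalars O).comp (TensorProduct.mk O (ResidueField O) F 1),
    fun f hf ↦ ?_⟩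
  have h1 : (1 : ResidueField O) ⊗ₜ[O] f = 0 := b.ext_elem fun l ↦ by simpa using hf l
  have h2 : f ∈ LinearMap.ker (TensorProduct.mk O (O ⧸ maximalIdeal O) F 1) := h1
  rw [LinearMap.ker_tensorProductMk] at h2
  have := Submodule.mem_map_of_mem (f := F.subtype) h2
  rwa [Submodule.map_smul'', Submodule.map_top, Submodule.range_subtype] at this

include hαβ hfrac hV in
/-- The image of the global functions in `O / 𝔪 ^ n` is finite dimensional. -/
theorem finite_quotient_comap_maximalIdeal_pow [IsNoetherianRing O] (n : ℕ) :
    Module.Finite k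
      (A ⧸ ((maximalIdeal O ^ n).comap (algebraMap A O)).restrictScalars k) := by
  induction n with
  | zero =>
    have : ((maximalIdeal O ^ 0).comap (algebraMap A O)).restrictScalars k = ⊤ := by
      rw [pow_zero, Ideal.one_eq_top, Ideal.comap_top]; rfl
    rw [this]
    infer_instance
  | succ n ih =>
    obtain ⟨r, Φ, hΦ⟩ := exists_linearMap_residueField_of_fg (maximalIdeal O ^ n)
      (IsNoetherian.noetherian _)
    set K := ((maximalIdeal O ^ n).comap (algebraMap A O)).restrictScalars k
    set K' := ((maximalIdeal O ^ (n + 1)).comap (algebraMap A O)).restrictScalars k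
    have hK : K' ≤ K := Ideal.comap_mono (Ideal.pow_le_pow_right n.le_succ)
    let ev : K →ₗ[k] (maximalIdeal O ^ n : Ideal O) :=
      { toFun := fun a ↦ ⟨algebraMap A O a, a.2⟩
        map_add' := fun a b ↦ Subtype.ext (map_add _ _ _)
        map_smul' := fun c a ↦ Subtype.ext (by
          simp [Algebra.smul_def, ← IsScalarTower.algebraMap_apply]) }
    let ψ : K →ₗ[k] Fin r → ResidueField O :=
      LinearMap.pi fun l ↦ ((Φ l).restrictScalars k).comp ev
    -- The residue field may be infinite over `k`; finiteness comes from the pole bounds on each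
    -- coordinate of global functions.
    have hfin : Module.Finite k (LinearMap.range ψ) := by
      have (l : Fin r) : FiniteDimensional k (LinearMap.range (((Φ l).restrictScalars k).comp ev)) :=
        finiteDimensional_map_of_linearMap_residueField α β hαβ hfrac hV _ (Φ l) _ <| by
          rintro m ⟨a, ha⟩
          exact ⟨a, a.2, ha⟩
      let j : LinearMap.range ψ →ₗ[k] ∀ l, LinearMap.range (((Φ l).restrictScalars k).comp ev) :=
        LinearMap.pi fun l ↦ ((LinearMap.proj l).comp (LinearMap.range ψ).subtype).codRestrict _ <| by
          rintro ⟨_, a, rfl⟩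
          exact ⟨a, rfl⟩
      refine Module.Finite.of_injective j fun x y hxy ↦ Subtype.ext (funext fun l ↦ ?_)
      exact congr_arg Subtype.val (congr_fun hxy l)
    have hker : LinearMap.ker ψ ≤ K'.comap K.subtype := fun a ha ↦ by
      change algebraMap A O (a : A) ∈ maximalIdeal O ^ (n + 1)
      rw [pow_succ']
      exact hΦ (ev a) fun l ↦ congr_fun ha l
    have h1 : Module.Finite k (K ⧸ K'.comap K.subtype) := by
      have : Module.Finite k (K ⧸ LinearMap.ker ψ) := .equiv ψ.quotKerEquivRange.symm
      exact .of_surjective (Submodule.factor hker) (Submodule.factor_surjective hker)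
    -- `A ⧸ K'` sits between `K ⧸ K'`, finite by the coordinates, and `A ⧸ K`, finite by induction.
    let f : (K ⧸ K'.comap K.subtype) →ₗ[k] (A ⧸ K') :=
      (K'.comap K.subtype).mapQ K' K.subtype le_rfl
    let g : (A ⧸ K') →ₗ[k] (A ⧸ K) := Submodule.factor hK
    have hfg : LinearMap.range f = LinearMap.ker g := by
      rw [Submodule.range_mapQ, Submodule.range_subtype, Submodule.ker_mapQ, Submodule.comap_id]
    have := isNoetherian_of_range_eq_ker f g hfg
    infer_instance

end LocalPart

/-- A noetherian ring embeds into finitely many of the quotients `B_𝔭 / 𝔭 ^ n B_𝔭`. -/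
theorem exists_finset_prime_pow_separating (B : Type*) [CommRing B] [IsNoetherianRing B] :
    ∃ (s : Finset (Ideal B)) (n : ℕ), (∀ p ∈ s, p.IsPrime) ∧
      ∀ b : B, (∀ p ∈ s, ∃ t ∉ p, t * b ∈ p ^ n) → b = 0 := by
  classical
  -- Take a primary decomposition of zero. Each component `q` contains a power of its radical, and
  -- `t * b ∈ q` with `t` outside the radical forces `b ∈ q`.
  obtain ⟨s, hs, hprim⟩ := Submodule.isLasker B B ⊥
  have hpow (q : Ideal B) : ∃ n : ℕ, q.radical ^ n ≤ q := q.exists_radical_pow_le_of_fg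
    (IsNoetherian.noetherian _)
  choose n hn using hpow
  refine ⟨s.image Ideal.radical, s.sup n, ?_, fun b hb ↦ ?_⟩
  · intro p hp
    obtain ⟨q, hq, rfl⟩ := Finset.mem_image.1 hp
    exact Ideal.isPrime_radical (hprim hq)
  · have : b ∈ s.inf id := by
      rw [Submodule.mem_finsetInf]
      intro q hq
      obtain ⟨t, ht, htb⟩ := hb _ (Finset.mem_image_of_mem _ hq)
      have h1 : t * b ∈ q := hn q (Ideal.pow_le_pow_right (Finset.le_sup hq) htb)
      have := (Ideal.isPrimary_iff.1 (hprim hq)).2 (mul_comm t b ▸ h1)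
      exact this.resolve_right ht
    rw [hs] at this
    exact this
end

/-! ### Valuation rings of residue fields and the valuative criterion -/

noncomputable section
open IsLocalRing

theorem AlgebraicGeometry.Scheme.fromSpecResidueField_appLE (X : Scheme.{u}) (x : X) (U : X.Opens)
    (hx : x ∈ U) (h) :
    (X.fromSpecResidueField x).appLE U ⊤ h ≫ (Scheme.ΓSpecIso (X.residueField x)).hom =
      X.evaluation U x hx := by
  have h' : X.fromSpecStalk x ⁻¹ᵁ U = ⊤ := by
    refine (IsLocalRing.closed_point_mem_iff (U := X.fromSpecStalk x ⁻¹ᵁ U)).1 ?_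
    change X.fromSpecStalk x (closedPoint _) ∈ U
    rwa [Scheme.fromSpecStalk_closedPoint]
  have h1 : (X.fromSpecStalk x).appLE U ⊤ h'.ge =
      X.presheaf.germ U x hx ≫ (Scheme.ΓSpecIso (X.presheaf.stalk x)).inv := by
    rw [Scheme.Hom.appLE, Scheme.fromSpecStalk_app hx, Category.assoc, Category.assoc,
      ← Functor.map_comp]
    congr 1
  have h2 := Scheme.Hom.appLE_comp_appLE (Spec.map (X.residue x)) (X.fromSpecStalk x) U ⊤ ⊤ h'.ge
    le_top
  have h3 : (Spec.map (X.residue x)).appLE ⊤ ⊤ le_top = (Spec.map (X.residue x)).appTop :=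
    Scheme.Hom.appLE_eq_app _
  refine (congr($h2.symm ≫ (Scheme.ΓSpecIso (X.residueField x)).hom)).trans ?_
  rw [h1, h3, Category.assoc, Category.assoc, Scheme.ΓSpecIso_naturality, Iso.inv_hom_id_assoc,
    Scheme.germ_residue]

theorem AlgebraicGeometry.Scheme.fromSpecResidueField_appTop (X : Scheme.{u}) (x : X) :
    (X.fromSpecResidueField x).appTop ≫ (Scheme.ΓSpecIso (X.residueField x)).hom =
      X.Γevaluation x := by
  rw [Scheme.Hom.appTop, Scheme.Hom.app_eq_appLE]
  exact X.fromSpecResidueField_appLE x ⊤ trivial le_top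

/-- The valuative criterion extends `Spec κ(x) ⟶ X` to `Spec V ⟶ X`. If the closed point of `V`
lands in `U i`, so does all of `Spec V`, since `V` is local; thus evaluation on `U i` factors
through `V`. -/
theorem exists_evaluation_range_le_valuationSubring {k : Type u} [Field k] {X : Scheme.{u}}
    (π : X ⟶ Spec (.of k)) [UniversallyClosed π] {ι : Type*} (U : ι → X.Opens)
    (hU : ∀ x, ∃ i, x ∈ U i) (x : X) (V : ValuationSubring (X.residueField x))
    (hV : ∀ r : k, X.Γevaluation x (π.appTop ((Scheme.ΓSpecIso (.of k)).inv r)) ∈ V) :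
    ∃ i, ∃ hx : x ∈ U i, (X.evaluation (U i) x hx).hom.range ≤ V.toSubring := by
  let j : k →+* V :=
    (((Scheme.ΓSpecIso (.of k)).inv ≫ π.appTop ≫ X.Γevaluation x).hom).codRestrict V hV
  have hj : CommRingCat.ofHom j ≫ CommRingCat.ofHom (algebraMap V (X.residueField x)) =
      (Scheme.ΓSpecIso (.of k)).inv ≫ π.appTop ≫ X.Γevaluation x := rfl
  have hw : X.fromSpecResidueField x ≫ π =
      Spec.map (CommRingCat.ofHom (algebraMap V (X.residueField x))) ≫
        Spec.map (CommRingCat.ofHom j) := by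
    rw [← Spec.map_comp, hj]
    refine ext_of_isAffine ?_
    rw [← cancel_epi (Scheme.ΓSpecIso (.of k)).inv,
      ← cancel_mono (Scheme.ΓSpecIso (X.residueField x)).hom, Category.assoc, Category.assoc,
      Scheme.ΓSpecIso_naturality, Iso.inv_hom_id_assoc, Scheme.Hom.comp_appTop, Category.assoc,
      Scheme.fromSpecResidueField_appTop]
  let S : ValuativeCommSq π :=
    { R := V
      K := X.residueField x
      i₁ := X.fromSpecResidueField x
      i₂ := Spec.map (CommRingCat.ofHom j)
      commSq := ⟨hw⟩ }
  have hex : ValuativeCriterion.Existence π := by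
    have : UniversallyClosed π := inferInstance
    rw [UniversallyClosed.eq_valuativeCriterion] at this
    exact this.1
  obtain ⟨⟨l, hl₁, hl₂⟩⟩ := hex S
  change Spec.map (CommRingCat.ofHom (algebraMap V (X.residueField x))) ≫ l =
    X.fromSpecResidueField x at hl₁
  obtain ⟨i, hi⟩ := hU (l (closedPoint V))
  have hl : l ⁻¹ᵁ U i = ⊤ := (IsLocalRing.closed_point_mem_iff (U := l ⁻¹ᵁ U i)).1 hi
  have hx : x ∈ U i := by
    have h1 : closedPoint (X.residueField x) ∈ X.fromSpecResidueField x ⁻¹ᵁ U i := by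
      rw [← hl₁, Scheme.Hom.comp_preimage, hl]
      trivial
    have h2 : X.fromSpecResidueField x (closedPoint (X.residueField x)) ∈ U i := h1
    exact Scheme.fromSpecResidueField_apply x _ ▸ h2
  refine ⟨i, hx, ?_⟩
  rintro _ ⟨s, rfl⟩
  have key : X.evaluation (U i) x hx = l.appLE (U i) ⊤ hl.ge ≫ (Scheme.ΓSpecIso (.of V)).hom ≫
      CommRingCat.ofHom (algebraMap V (X.residueField x)) := by
    rw [← Scheme.ΓSpecIso_naturality]
    rw [Scheme.Hom.appTop, Scheme.Hom.app_eq_appLE]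
    erw [Scheme.Hom.appLE_comp_appLE_assoc]
    have h : ⊤ ≤ X.fromSpecResidueField x ⁻¹ᵁ U i := by
      rw [← hl₁, Scheme.Hom.comp_preimage, hl]
      rfl
    rw [← X.fromSpecResidueField_appLE x (U i) hx h]
    simp only [hl₁]
    rfl
  rw [key]
  exact ((l.appLE (U i) ⊤ hl.ge ≫ (Scheme.ΓSpecIso (.of V)).hom) s).2
end

/-! ### Finiteness of global functions over a perfect field -/

noncomputable section
open IsLocalRing

/-- The structure map `R ⟶ Γ(X, 𝒪_X)` of a scheme over `Spec R`. -/
def structureRingHom {R : CommRingCat.{u}} {X : Scheme.{u}} (π : X ⟶ Spec R) : R ⟶ Γ(X, ⊤) :=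
  (Scheme.ΓSpecIso R).inv ≫ π.appTop

theorem finiteType_structureRingHom_comp_res {k : Type u} [Field k] {X : Scheme.{u}}
    (π : X ⟶ Spec (.of k)) [LocallyOfFiniteType π] {U : X.Opens} (hU : IsAffineOpen U) :
    (structureRingHom π ≫ X.presheaf.map (homOfLE (le_top : U ≤ ⊤)).op).hom.FiniteType := by
  have h1 := π.finiteType_appLE (isAffineOpen_top _) hU le_top
  have h2 : structureRingHom π ≫ X.presheaf.map (homOfLE (le_top : U ≤ ⊤)).op =
      (Scheme.ΓSpecIso (.of k)).inv ≫ π.appLE ⊤ U le_top := by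
    rw [structureRingHom, Category.assoc]
    rfl
  rw [h2, CommRingCat.hom_comp]
  exact h1.comp (RingHom.FiniteType.of_surjective _
    (ConcreteCategory.bijective_of_isIso (Scheme.ΓSpecIso (.of k)).inv).2)

/-- The local result is applied with `B` ranging over the charts through `x` only. These suffice:
the chart produced by the valuative criterion always contains `x`, and the stalk is a localization
of the sections of each of them. -/
theorem finite_quotient_comap_germ {k : Type u} [Field k] [PerfectField k] {X : Scheme.{u}}
    (π : X ⟶ Spec (.of k)) [UniversallyClosed π] [LocallyOfFiniteType π] [IsLocallyNoetherian X]
    {ι : Type*} [Finite ι] (U : ι → X.affineOpens) (hU : ∀ x, ∃ i, x ∈ (U i).1) (x : X) (n : ℕ) :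
    letI := (structureRingHom π).hom.toAlgebra
    Module.Finite k (Γ(X, ⊤) ⧸ ((maximalIdeal (X.presheaf.stalk x) ^ n).comap
      (X.presheaf.germ ⊤ x trivial).hom).restrictScalars k) := by
  let _ : Algebra k Γ(X, ⊤) := (structureRingHom π).hom.toAlgebra
  let _ : Algebra Γ(X, ⊤) (X.presheaf.stalk x) := (X.presheaf.germ ⊤ x trivial).hom.toAlgebra
  let _ : Algebra k (X.presheaf.stalk x) :=
    (structureRingHom π ≫ X.presheaf.germ ⊤ x trivial).hom.toAlgebra
  have : IsScalarTower k Γ(X, ⊤) (X.presheaf.stalk x) := .of_algebraMap_eq fun _ ↦ rfl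
  have hess : Algebra.EssFiniteType k (ResidueField (X.presheaf.stalk x)) := by
    obtain ⟨i, hi⟩ := hU x
    let _ : Algebra Γ(X, (U i).1) (X.presheaf.stalk x) := (X.presheaf.germ (U i).1 x hi).hom.toAlgebra
    have : IsLocalization.AtPrime (X.presheaf.stalk x) ((U i).2.primeIdealOf ⟨x, hi⟩).asIdeal :=
      (U i).2.isLocalization_stalk ⟨x, hi⟩
    let _ : Algebra k Γ(X, (U i).1) := (structureRingHom π ≫
      X.presheaf.map (homOfLE (le_top : (U i).1 ≤ ⊤)).op).hom.toAlgebra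
    have : Algebra.FiniteType k Γ(X, (U i).1) := finiteType_structureRingHom_comp_res π (U i).2
    have : IsScalarTower k Γ(X, (U i).1) (X.presheaf.stalk x) := .of_algebraMap_eq fun r ↦ by
      simp only [RingHom.algebraMap_toAlgebra]
      rw [← RingHom.comp_apply, ← CommRingCat.hom_comp, Category.assoc, X.presheaf.germ_res]
    have : Algebra.EssFiniteType Γ(X, (U i).1) (X.presheaf.stalk x) :=
      .of_isLocalization _ ((U i).2.primeIdealOf ⟨x, hi⟩).asIdeal.primeCompl
    have : Algebra.EssFiniteType k (X.presheaf.stalk x) := .comp _ Γ(X, (U i).1) _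
    exact inferInstanceAs (Algebra.EssFiniteType k
      (X.presheaf.stalk x ⧸ maximalIdeal (X.presheaf.stalk x)))
  have hnoeth (i : {i // x ∈ (U i).1}) : IsNoetherianRing Γ(X, (U i.1).1) :=
    IsLocallyNoetherian.component_noetherian (U i.1)
  refine finite_quotient_comap_maximalIdeal_pow (k := k) (A := Γ(X, ⊤)) (O := X.presheaf.stalk x)
    (ι := {i // x ∈ (U i).1}) (B := fun i ↦ Γ(X, (U i.1).1))
    (fun i ↦ (X.presheaf.map (homOfLE le_top).op).hom) (fun i ↦ (X.presheaf.germ _ x i.2).hom)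
    ?_ ?_ ?_ n
  · intro i a
    rw [← RingHom.comp_apply, ← CommRingCat.hom_comp, X.presheaf.germ_res]
    rfl
  · intro i y
    let _ : Algebra Γ(X, (U i.1).1) (X.presheaf.stalk x) :=
      (X.presheaf.germ (U i.1).1 x i.2).hom.toAlgebra
    have : IsLocalization.AtPrime (X.presheaf.stalk x) ((U i.1).2.primeIdealOf ⟨x, i.2⟩).asIdeal :=
      (U i.1).2.isLocalization_stalk ⟨x, i.2⟩
    obtain ⟨⟨b, s⟩, h⟩ :=
      IsLocalization.surj ((U i.1).2.primeIdealOf ⟨x, i.2⟩).asIdeal.primeCompl y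
    refine ⟨b, s, ?_, h⟩
    have : IsUnit (algebraMap Γ(X, (U i.1).1) (X.presheaf.stalk x) s) :=
      IsLocalization.map_units _ s
    exact fun h ↦ (mem_maximalIdeal _).1 h this
  · intro V hV
    obtain ⟨i, hi, h⟩ := exists_evaluation_range_le_valuationSubring π (fun i ↦ (U i).1) hU x V hV
    exact ⟨⟨i, hi⟩, h⟩

/-- The ring of global functions on a proper scheme over a perfect field is finite dimensional. -/
theorem finite_structureRingHom_of_perfectField {k : Type u} [Field k] [PerfectField k]
    {X : Scheme.{u}} (π : X ⟶ Spec (.of k)) [UniversallyClosed π] [LocallyOfFiniteType π] :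
    (structureRingHom π).hom.Finite := by
  have : IsLocallyNoetherian X := LocallyOfFiniteType.isLocallyNoetherian π
  have : CompactSpace X := compactSpace_of_universallyClosed π
  obtain ⟨I, hI, hIU⟩ := 
    (isCompact_iff_finite_and_eq_biUnion_affineOpens (U := (⊤ : X.Opens))).1 isCompact_univ
  have : Finite I := hI.to_subtype
  have hU (x : X) : ∃ i : I, x ∈ i.1.1 := by
    have : x ∈ (⊤ : X.Opens) := trivial
    rw [hIU] at this
    simpa using this
  have hnoeth (i : I) : IsNoetherianRing Γ(X, i.1.1) :=
    IsLocallyNoetherian.component_noetherian i.1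
  choose s n hs hsn using fun i : I ↦ exists_finset_prime_pow_separating Γ(X, i.1.1)
  let _ : Algebra k Γ(X, ⊤) := (structureRingHom π).hom.toAlgebra
  -- The points are those of the separating primes in each chart, so a function dying in every `Γ(X,
  -- ⊤) ⧸ K j` vanishes on every chart.
  let pt (j : Σ i : I, s i) : X := j.1.1.2.fromSpec ⟨j.2.1, hs j.1 _ j.2.2⟩
  let K (j : Σ i : I, s i) : Submodule k Γ(X, ⊤) :=
    ((maximalIdeal (X.presheaf.stalk (pt j)) ^ n j.1).comap
      (X.presheaf.germ ⊤ (pt j) trivial).hom).restrictScalars k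
  have hK (j) : Module.Finite k (Γ(X, ⊤) ⧸ K j) :=
    finite_quotient_comap_germ π (fun i : I ↦ i.1) hU (pt j) (n j.1)
  let φ : Γ(X, ⊤) →ₗ[k] ∀ j, Γ(X, ⊤) ⧸ K j := LinearMap.pi fun j ↦ (K j).mkQ
  change Module.Finite k Γ(X, ⊤)
  refine Module.Finite.of_injective φ ((injective_iff_map_eq_zero _).2 fun a ha ↦ ?_)
  refine X.sheaf.eq_of_locally_eq' (fun i : I ↦ i.1.1) ⊤ (fun i ↦ homOfLE le_top)
    (fun x _ ↦ by simpa using hU x) a 0 fun i ↦ ?_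
  refine Eq.trans ?_ (map_zero (X.presheaf.map (homOfLE (le_top : i.1.1 ≤ ⊤)).op).hom).symm
  refine hsn i _ fun p hp ↦ ?_
  let j : Σ i : I, s i := ⟨i, p, hp⟩
  have hj : pt j ∈ i.1.1 := by
    have : pt j ∈ Set.range i.1.2.fromSpec := ⟨_, rfl⟩
    rwa [i.1.2.range_fromSpec] at this
  have h1 : X.presheaf.germ ⊤ (pt j) trivial a ∈ maximalIdeal (X.presheaf.stalk (pt j)) ^ n i :=
    (Submodule.Quotient.mk_eq_zero (K j)).1 (congr_fun ha j)
  let _ : Algebra Γ(X, i.1.1) (X.presheaf.stalk (pt j)) :=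
    (X.presheaf.germ i.1.1 (pt j) hj).hom.toAlgebra
  have := hs i p hp
  have : IsLocalization.AtPrime (X.presheaf.stalk (pt j)) p :=
    i.1.2.isLocalization_stalk' ⟨p, hs i p hp⟩ hj
  rw [← IsLocalization.AtPrime.map_eq_maximalIdeal p, ← Ideal.map_pow,
    ← X.presheaf.germ_res (homOfLE le_top) (pt j) hj] at h1
  exact (IsLocalization.algebraMap_mem_map_algebraMap_iff p.primeCompl
    (X.presheaf.stalk (pt j)) _ _).1 h1
end

/-! ### Descent of finiteness to an arbitrary field -/

noncomputable section

theorem RingHom.Finite.of_isPushout_of_faithfullyFlat {R S R' S' : CommRingCat.{u}} {φ : R ⟶ S}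
    {ψ : R ⟶ R'} {a : S ⟶ S'} {b : R' ⟶ S'} (h : IsPushout φ ψ a b) (hψ : ψ.hom.FaithfullyFlat)
    (hb : b.hom.Finite) : φ.hom.Finite := by
  algebraize [φ.hom, ψ.hom, a.hom, b.hom, (φ ≫ a).hom]
  have : IsScalarTower R S S' := .of_algebraMap_eq fun _ ↦ rfl
  have : IsScalarTower R R' S' := .of_algebraMap_eq fun r ↦ congr($(h.w) r)
  have : Algebra.IsPushout R S R' S' := CommRingCat.isPushout_iff_isPushout.1 h
  have : Algebra.IsPushout R R' S S' := .symm this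
  exact RingHom.Finite.codescendsAlong_faithfullyFlat (R := R) (R' := R') (S := S) (S' := S') hψ hb

/-- Over a noetherian ring a submodule of a finite module is finite. This allows base change of
sections to be used knowing only its injectivity. -/
theorem RingHom.Finite.of_comp_mono {R S T : CommRingCat.{u}} [IsNoetherianRing R] (f : R ⟶ S)
    (g : S ⟶ T) [Mono g] (h : (f ≫ g).hom.Finite) : f.hom.Finite := by
  algebraize [f.hom, g.hom, (f ≫ g).hom]
  have : IsScalarTower R S T := .of_algebraMap_eq fun _ ↦ rfl
  exact Module.Finite.of_injective (IsScalarTower.toAlgHom R S T).toLinearMap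
    (ConcreteCategory.injective_of_mono_of_preservesPullback g)

/-- The ring of global functions on a proper scheme over a field is finite dimensional. -/
theorem finite_structureRingHom {k : Type u} [Field k] {X : Scheme.{u}} (π : X ⟶ Spec (.of k))
    [UniversallyClosed π] [LocallyOfFiniteType π] :
    (structureRingHom π).hom.Finite := by
  let K := AlgebraicClosure k
  let f : Spec (.of K) ⟶ Spec (.of k) := Spec.map (CommRingCat.ofHom (algebraMap k K))
  have H := IsPullback.of_hasPullback π f
  have : CompactSpace X := compactSpace_of_universallyClosed π
  have : Flat f := by
    refine Flat.SpecMap_iff.2 ?_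
    exact (RingHom.flat_algebraMap_iff).2 inferInstance
  -- Only injectivity of `Γ(X) ⊗ K ⟶ Γ(X_K)` is obtained; it needs compactness of `X` but no
  -- separation hypothesis, and is enough since `K` is noetherian.
  have hm := mono_pushoutSection_of_isCompact_of_flat_right H (US := ⊤) (UT := ⊤) (UX := ⊤) (UY := ⊤)
    le_top le_top (by simp) (isAffineOpen_top _) (isAffineOpen_top _) isCompact_univ
  have hfin : (Limits.pullback.snd π f).appTop.hom.Finite := by
    have h1 := finite_structureRingHom_of_perfectField (Limits.pullback.snd π f)
    have h2 : (Limits.pullback.snd π f).appTop =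
        (Scheme.ΓSpecIso (.of K)).hom ≫ structureRingHom (Limits.pullback.snd π f) := by
      rw [structureRingHom, Iso.hom_inv_id_assoc]
    rw [h2, CommRingCat.hom_comp]
    exact h1.comp (RingHom.Finite.of_surjective _
      (ConcreteCategory.bijective_of_isIso (Scheme.ΓSpecIso (.of K)).hom).2)
  have hinr : (Limits.pushout.inr (π.appLE ⊤ ⊤ le_top) (f.appLE ⊤ ⊤ le_top)).hom.Finite := by
    have : IsNoetherianRing Γ(Spec (.of K), ⊤) := inferInstance
    refine RingHom.Finite.of_comp_mono _ (pushoutSection H (US := ⊤) (UT := ⊤) (UX := ⊤) (UY := ⊤)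
      le_top le_top _) ?_
    rw [Limits.pushout.inr_desc]
    rwa [Scheme.Hom.appTop, Scheme.Hom.app_eq_appLE] at hfin
  have hψ : (f.appLE ⊤ ⊤ le_top).hom.FaithfullyFlat := by
    have h5 : f.appLE ⊤ ⊤ le_top = (Scheme.ΓSpecIso (.of k)).hom ≫
        CommRingCat.ofHom (algebraMap k K) ≫ (Scheme.ΓSpecIso (.of K)).inv := by
      refine f.appLE_eq_app.trans ?_
      rw [Scheme.ΓSpecIso_inv_naturality, Iso.hom_inv_id_assoc]
    rw [h5, CommRingCat.hom_comp, CommRingCat.hom_comp]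
    refine RingHom.FaithfullyFlat.stableUnderComposition _ _ (.of_bijective ?_)
      (RingHom.FaithfullyFlat.stableUnderComposition _ _ ?_ (.of_bijective ?_))
    · exact ConcreteCategory.bijective_of_isIso (Scheme.ΓSpecIso (.of k)).hom
    · exact RingHom.faithfullyFlat_algebraMap_iff.2 inferInstance
    · exact ConcreteCategory.bijective_of_isIso (Scheme.ΓSpecIso (.of K)).inv
  have h3 := RingHom.Finite.of_isPushout_of_faithfullyFlat
    (IsPushout.of_hasPushout (π.appLE ⊤ ⊤ le_top) (f.appLE ⊤ ⊤ le_top)) hψ hinr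
  have h4 : π.appTop = π.appLE ⊤ ⊤ le_top := by
    rw [Scheme.Hom.appTop, Scheme.Hom.app_eq_appLE]
    rfl
  rw [structureRingHom, h4, CommRingCat.hom_comp]
  exact h3.comp (RingHom.Finite.of_surjective _
    (ConcreteCategory.bijective_of_isIso (Scheme.ΓSpecIso (.of k)).inv).2)
end

noncomputable section

/-! ### The degree one Milnor K-theory sheaf is the sheaf of units -/

/-- A Steinberg relation needs two adjacent tensor positions, and `Fin 1` has only one. -/
theorem steinbergRelations_one (R : Type u) [CommRing R] : steinbergRelations 1 R = ⊥ := by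
  refine Submodule.span_eq_bot.2 ?_
  rintro x ⟨a, i, j, hij, -⟩
  omega

/-- `K^M_1(R) = Rˣ`. -/
def milnorKOneEquiv (R : Type u) [CommRing R] : MilnorK 1 R ≃+ Additive Rˣ :=
  ((Submodule.quotEquivOfEqBot _ (steinbergRelations_one R)).trans
    (PiTensorProduct.subsingletonEquiv (s := fun _ ↦ Additive Rˣ) (0 : Fin 1))).toAddEquiv

theorem milnorKOneEquiv_map {R S : Type u} [CommRing R] [CommRing S] (f : R →+* S)
    (x : MilnorK 1 R) : milnorKOneEquiv S (MilnorK.map 1 f x) =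
      MonoidHom.toAdditive (Units.map (f : R →* S)) (milnorKOneEquiv R x) := by
  obtain ⟨x, rfl⟩ := Submodule.Quotient.mk_surjective _ x
  induction x using PiTensorProduct.induction_on with
  | smul_tprod r a =>
    simp [milnorKOneEquiv, MilnorK.map, unitsTensorMap, PiTensorProduct.subsingletonEquiv_apply_tprod]
  | add x y hx hy => simp only [Submodule.Quotient.mk_add, map_add, hx, hy]

/-- The presheaf of units of a presheaf of rings. -/
def unitsPresheaf {C : Type w} [Category.{v} C] (F : Cᵒᵖ ⥤ CommRingCat.{u}) : Cᵒᵖ ⥤ Type u where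
  obj X := (F.obj X)ˣ
  map f := ↾fun x ↦ Units.map ((F.map f).hom : F.obj _ →* F.obj _) x
  map_id X := by
    ext x
    change F.map (𝟙 X) x.1 = x.1
    rw [F.map_id]
    rfl
  map_comp f g := by
    ext x
    change F.map (f ≫ g) x.1 = F.map g (F.map f x.1)
    rw [F.map_comp]
    rfl

/-- Units and their inverses are glued separately; the product of the two glued sections is locally,
hence globally, `1`. -/
theorem isSheaf_unitsPresheaf {C : Type w} [Category.{v} C] (J : GrothendieckTopology C)
    (F : Cᵒᵖ ⥤ CommRingCat.{u}) (hF : Presieve.IsSheaf J (F ⋙ forget CommRingCat)) :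
    Presieve.IsSheaf J (unitsPresheaf F) := by
  intro X S hS x hx
  have hFS := hF S hS
  let y : Presieve.FamilyOfElements (F ⋙ forget CommRingCat) S.arrows :=
    fun Y f hf ↦ Units.val (α := F.obj (op Y)) (x f hf)
  let z : Presieve.FamilyOfElements (F ⋙ forget CommRingCat) S.arrows :=
    fun Y f hf ↦ Units.inv (α := F.obj (op Y)) (x f hf)
  have hy : y.Compatible := fun Y₁ Y₂ Z g₁ g₂ f₁ f₂ h₁ h₂ e ↦
    congr_arg (Units.val (α := F.obj (op Z))) (hx g₁ g₂ h₁ h₂ e)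
  have hz : z.Compatible := fun Y₁ Y₂ Z g₁ g₂ f₁ f₂ h₁ h₂ e ↦
    congr_arg (Units.inv (α := F.obj (op Z))) (hx g₁ g₂ h₁ h₂ e)
  obtain ⟨s, hs, -⟩ := hFS y hy
  obtain ⟨t, ht, -⟩ := hFS z hz
  have hst : (show F.obj (op X) from s) * t = 1 := hFS.isSeparatedFor.ext fun Y f hf ↦ by
    have h1 : F.map f.op s = Units.val (α := F.obj (op Y)) (x f hf) := hs f hf
    have h2 : F.map f.op t = Units.inv (α := F.obj (op Y)) (x f hf) := ht f hf
    change F.map f.op ((show F.obj (op X) from s) * t) = F.map f.op 1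
    rw [map_mul, map_one]
    exact (congr_arg₂ (· * ·) h1 h2).trans (Units.val_inv (α := F.obj (op Y)) (x f hf))
  let u : (F.obj (op X))ˣ := ⟨s, t, hst, (mul_comm _ _).trans hst⟩
  refine ⟨u, fun Y f hf ↦ Units.ext (α := F.obj (op Y)) (hs f hf),
    fun u' hu' ↦ Units.ext (α := F.obj (op X)) ?_⟩
  refine hFS.isSeparatedFor.ext fun Y f hf ↦ ?_
  exact (congr_arg (Units.val (α := F.obj (op Y))) (hu' f hf)).trans (hs f hf).symm

/-- Global functions are represented by the affine line over `ℤ`, and the Zariski topology is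
subcanonical. -/
theorem isSheaf_Γ_forget :
    Presieve.IsSheaf Scheme.zariskiTopology.{u} (Scheme.Γ.{u} ⋙ forget CommRingCat) := by
  refine (Presieve.isSheaf_iff_of_nat_equiv (P₁ := yoneda.obj (Spec (.of
      (MvPolynomial PUnit.{u + 1} (ULift.{u} ℤ)))))
    (fun Y ↦ (AffineSpace.toSpecMvPolyIntEquiv PUnit.{u + 1}).trans (Equiv.funUnique _ _))
    (fun Y Z f x ↦ rfl)).1 (GrothendieckTopology.Subcanonical.isSheaf_of_isRepresentable _)

/-- The sheaf condition may be tested on underlying sets, where the presheaf is that of units.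
Sheafification therefore changes nothing in degree one. -/
theorem isSheaf_milnorKPresheaf_one (X : Scheme.{u}) :
    Presheaf.IsSheaf (Scheme.zariskiTopology.{u}.over X) (milnorKPresheaf 1 X) := by
  have h : Presheaf.IsSheaf Scheme.zariskiTopology.{u}
      (Scheme.Γ ⋙ milnorKFunctor 1 ⋙ AddCommGrpCat.uliftFunctor.{u + 1, u}) := by
    rw [Presheaf.isSheaf_iff_isSheaf_forget _ _ (forget AddCommGrpCat), isSheaf_iff_isSheaf_of_type]
    refine (Presieve.isSheaf_iff_of_nat_equiv (P₁ := unitsPresheaf Scheme.Γ.{u})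
      (P₂ := (Scheme.Γ ⋙ milnorKFunctor 1 ⋙ AddCommGrpCat.uliftFunctor.{u + 1, u}) ⋙ forget AddCommGrpCat)
      (fun Y ↦ ((milnorKOneEquiv _).toEquiv.trans Additive.toMul).symm.trans Equiv.ulift.symm)
      (fun Y Z f x ↦ congr_arg ULift.up ?_)).1 (isSheaf_unitsPresheaf _ _ isSheaf_Γ_forget)
    refine (milnorKOneEquiv _).injective ?_
    refine ((milnorKOneEquiv _).apply_symm_apply _).trans ?_
    refine Eq.trans ?_ (milnorKOneEquiv_map _ _).symm
    exact congr_arg (MonoidHom.toAdditive (Units.map _)) ((milnorKOneEquiv _).apply_symm_apply _).symm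
  exact (Over.forget X).op_comp_isSheaf (Scheme.zariskiTopology.over X) Scheme.zariskiTopology ⟨_, h⟩

/-- The sections of the degree one Milnor K-theory sheaf are the units. -/
def unitsMulEquivMilnorKSheaf (X : Scheme.{u}) (Z : (Over X)ᵒᵖ) :
    Γ(Z.unop.left, ⊤)ˣ ≃* Multiplicative ((milnorKSheaf 1 X).obj.obj Z) :=
  (AddEquiv.toMultiplicativeRight (milnorKOneEquiv _)).symm.trans (AddEquiv.toMultiplicative
    (AddEquiv.ulift.symm.trans
    ((isoSheafify _ (isSheaf_milnorKPresheaf_one X)).app Z).addCommGroupIsoToAddEquiv))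

theorem unitsMulEquivMilnorKSheaf_naturality (X : Scheme.{u}) {Z Z' : (Over X)ᵒᵖ} (f : Z ⟶ Z')
    (u : Γ(Z.unop.left, ⊤)ˣ) :
    Multiplicative.ofAdd ((milnorKSheaf 1 X).obj.map f (unitsMulEquivMilnorKSheaf X Z u).toAdd) =
      unitsMulEquivMilnorKSheaf X Z' (Units.map f.unop.left.appTop.hom u) := by
  let m : (milnorKPresheaf 1 X).obj Z :=
    ULift.up ((milnorKOneEquiv Γ(Z.unop.left, ⊤)).symm (Additive.ofMul u))
  have h := ConcreteCategory.congr_hom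
    ((isoSheafify _ (isSheaf_milnorKPresheaf_one X)).hom.naturality f) m
  refine (congr_arg Multiplicative.ofAdd h.symm).trans (congr_arg (fun y ↦ Multiplicative.ofAdd
    ((isoSheafify _ (isSheaf_milnorKPresheaf_one X)).hom.app Z' y)) (congr_arg ULift.up ?_))
  refine (milnorKOneEquiv _).injective ((milnorKOneEquiv_map _ _).trans ?_)
  refine Eq.trans ?_ ((milnorKOneEquiv _).apply_symm_apply _).symm
  exact congr_arg (MonoidHom.toAdditive (Units.map _)) ((milnorKOneEquiv _).apply_symm_apply _)
end

noncomputable section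

/-! ### Base change of global sections along an affine base -/

open Limits

/-- A morphism of sheaves that is bijective on a class of objects over which every object can be
covered is bijective. -/
theorem Presieve.IsSheaf.bijective_of_covers {C : Type w} [Category.{v} C]
    {J : GrothendieckTopology C} {P Q : Cᵒᵖ ⥤ Type u} (hP : Presieve.IsSheaf J P)
    (hQ : Presieve.IsSheaf J Q) (φ : P ⟶ Q) (A : C → Prop)
    (hA : ∀ Z, A Z → Function.Bijective (φ.app (op Z)))
    (hcov : ∀ T, ∃ R : Presieve T, Sieve.generate R ∈ J T ∧ ∀ ⦃Z⦄ (h : Z ⟶ T), R h → A Z) (T : C) :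
    Function.Bijective (φ.app (op T)) := by
  -- Injectivity is needed at every object: overlaps of a cover need not satisfy `A`, yet the local
  -- preimages must agree on them.
  have hinj (T : C) : Function.Injective (φ.app (op T)) := by
    intro a b hab
    obtain ⟨R, hR, hRA⟩ := hcov T
    refine ((Presieve.isSheafFor_iff_generate R).2 (hP _ hR)).isSeparatedFor.ext fun Z h hh ↦ ?_
    refine (hA Z (hRA h hh)).1 ?_
    rw [NatTrans.naturality_apply, NatTrans.naturality_apply, hab]
  refine ⟨hinj T, fun q ↦ ?_⟩
  obtain ⟨R, hR, hRA⟩ := hcov T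
  choose p hp using fun (Z : C) (h : Z ⟶ T) (hh : R h) ↦ (hA Z (hRA h hh)).2 (Q.map h.op q)
  obtain ⟨x, hx, -⟩ := (Presieve.isSheafFor_iff_generate R).2 (hP _ hR) p (by
    intro Y₁ Y₂ Z g₁ g₂ f₁ f₂ h₁ h₂ e
    refine hinj Z ?_
    rw [NatTrans.naturality_apply, NatTrans.naturality_apply, hp, hp, ← comp_apply, ← comp_apply,
      ← Q.map_comp, ← Q.map_comp, ← op_comp, ← op_comp, e])
  refine ⟨x, ((Presieve.isSheafFor_iff_generate R).2 (hQ _ hR)).isSeparatedFor.ext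
    fun Z h hh ↦ ?_⟩
  rw [← NatTrans.naturality_apply, hx h hh, hp]

theorem exists_affine_presieve_generate_mem {Y : Scheme.{u}} (T : Over Y) :
    ∃ R : Presieve T, Sieve.generate R ∈ Scheme.zariskiTopology.over Y T ∧
      ∀ ⦃Z : Over Y⦄ (h : Z ⟶ T), R h → IsAffine Z.left := by
  refine ⟨Presieve.ofArrows (fun i ↦ Over.mk (T.left.affineCover.f i ≫ T.hom))
    (fun i ↦ Over.homMk (T.left.affineCover.f i)), ?_, ?_⟩
  · rw [GrothendieckTopology.mem_over_iff]
    change Sieve.overEquiv T (Sieve.ofArrows _ _) ∈ _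
    rw [Sieve.overEquiv_ofArrows]
    exact T.left.affineCover.mem_grothendieckTopology
  · rintro _ _ ⟨i⟩
    dsimp
    infer_instance

/-- The functor `T ↦ Γ(T ×_Y X, 𝒪)` on `Y`-schemes. -/
def pullbackSections {X Y : Scheme.{u}} (π : X ⟶ Y) : (Over Y)ᵒᵖ ⥤ CommRingCat.{u} :=
  (Over.pullback π).op ⋙ (Over.forget X).op ⋙ Scheme.Γ

theorem isSheaf_pullbackSections_forget {X Y : Scheme.{u}} (π : X ⟶ Y) :
    Presieve.IsSheaf (Scheme.zariskiTopology.over Y)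
      (pullbackSections π ⋙ forget CommRingCat) := by
  rw [← isSheaf_iff_isSheaf_of_type]
  have h := (Over.forget X).op_comp_isSheaf (Scheme.zariskiTopology.over X) Scheme.zariskiTopology
    ⟨_, (isSheaf_iff_isSheaf_of_type _ _).2 isSheaf_Γ_forget⟩
  exact (Over.pullback π).op_comp_isSheaf (Scheme.zariskiTopology.over Y)
    (Scheme.zariskiTopology.over X) ⟨_, h⟩

theorem pullback_map_comp_lift {X S Y T T' : Scheme.{u}} (π : X ⟶ Y) (ρ : S ⟶ Y) (j : X ⟶ S)
    (hj : j ≫ ρ = π) (t : T ⟶ Y) (t' : T' ⟶ Y) (f : T' ⟶ T) (hf : f ≫ t = t') :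
    pullback.map t' π t' ρ (𝟙 _) j (𝟙 _) (by simp) (by simp [hj]) ≫
        pullback.lift (f := t) (pullback.fst t' ρ ≫ f) (pullback.snd t' ρ)
          (by simp [hf, pullback.condition]) =
      pullback.lift (pullback.fst t' π ≫ f) (pullback.snd t' π)
          (by simp [hf, pullback.condition]) ≫
        pullback.map t π t ρ (𝟙 _) j (𝟙 _) (by simp) (by simp [hj]) := by
  apply pullback.hom_ext
  · refine (Category.assoc _ _ _).trans (Eq.trans ?_ (Category.assoc _ _ _).symm)
    rw [pullback.lift_fst, pullback.lift_fst, pullback.lift_fst_assoc,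
      Category.comp_id, Category.comp_id, pullback.lift_fst]
  · refine (Category.assoc _ _ _).trans (Eq.trans ?_ (Category.assoc _ _ _).symm)
    rw [pullback.lift_snd, pullback.lift_snd, pullback.lift_snd,
      pullback.lift_snd_assoc]

/-- The map `Γ(T ×_Y S, 𝒪) ⟶ Γ(T ×_Y X, 𝒪)` induced by a `Y`-morphism `X ⟶ S`. -/
def pullbackSectionsMap {X S Y : Scheme.{u}} (π : X ⟶ Y) (ρ : S ⟶ Y) (j : X ⟶ S)
    (hj : j ≫ ρ = π) : pullbackSections ρ ⟶ pullbackSections π where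
  app T := (pullback.map T.unop.hom π T.unop.hom ρ (𝟙 _) j (𝟙 _) (by simp) (by simp [hj])).appTop
  naturality T T' f := by
    refine (Scheme.Hom.comp_appTop _ _).symm.trans
      (Eq.trans (congr_arg Scheme.Hom.appTop ?_) (Scheme.Hom.comp_appTop _ _))
    exact pullback_map_comp_lift π ρ j hj _ _ f.unop.left (Over.w f.unop)

/-- Flat base change in degree zero: sections on the fibre product are the tensor product of the
global sections. -/
theorem isPushout_appTop_of_flat {X Y T : Scheme.{u}} (π : X ⟶ Y) (t : T ⟶ Y) [Flat t]
    [IsAffine Y] [IsAffine T] [QuasiCompact π] [QuasiSeparated π] :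
    IsPushout π.appTop t.appTop (pullback.snd t π).appTop (pullback.fst t π).appTop := by
  have : CompactSpace X := QuasiCompact.compactSpace_of_compactSpace π
  have : QuasiSeparatedSpace X := by
    exact (quasiSeparated_iff_quasiSeparatedSpace π).1 inferInstance
  have h := isIso_pushoutSection_of_isQuasiSeparated_of_flat_right
    (IsPullback.of_hasPullback t π).flip (US := ⊤) (UT := ⊤) (UX := ⊤) le_top le_top (UY := ⊤)
    (by simp) (isAffineOpen_top _) (isAffineOpen_top _) isCompact_univ
    (isQuasiSeparated_univ)
  have key {X Y : Scheme.{u}} (f : X ⟶ Y) : f.appLE ⊤ ⊤ le_top = f.appTop := f.appLE_eq_app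
  simpa only [key] using (isIso_pushoutSection_iff _ _ _ _).1 h

/-- For affine `T` both sides are base changes along `T` of the global sections of `S` and `X`,
which `j` identifies; cancelling pushout squares gives the claim there, and the sheaf property gives
it for all `T`. -/
theorem bijective_pullbackSectionsMap {X S Y : Scheme.{u}} (π : X ⟶ Y) (ρ : S ⟶ Y) (j : X ⟶ S)
    (hj : j ≫ ρ = π) [IsAffine Y] [QuasiCompact π] [QuasiSeparated π] [QuasiCompact ρ]
    [QuasiSeparated ρ] (hY : ∀ T : Over Y, Flat T.hom) [IsIso j.appTop] (T : Over Y) :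
    Function.Bijective ((pullbackSectionsMap π ρ j hj).app (op T)) := by
  refine Presieve.IsSheaf.bijective_of_covers (isSheaf_pullbackSections_forget ρ)
    (isSheaf_pullbackSections_forget π)
    (Functor.whiskerRight (pullbackSectionsMap π ρ j hj) (forget CommRingCat))
    (fun T ↦ IsAffine T.left) (fun T hT ↦ ?_) exists_affine_presieve_generate_mem T
  have := hY T
  have h1 := isPushout_appTop_of_flat ρ T.hom
  have h2 := isPushout_appTop_of_flat π T.hom
  set m := pullback.map T.hom π T.hom ρ (𝟙 _) j (𝟙 _) (by simp) (by simp [hj]) with hm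
  have h3 : IsPushout j.appTop (pullback.snd T.hom ρ).appTop (pullback.snd T.hom π).appTop
      m.appTop := by
    refine IsPushout.of_left (h₁₁ := ρ.appTop) (h₂₁ := (pullback.fst T.hom ρ).appTop)
      (v₁₁ := T.hom.appTop) ?_ ?_ h1
    · rw [← Scheme.Hom.comp_appTop, ← Scheme.Hom.comp_appTop, hj, hm, pullback.lift_fst,
        Category.comp_id]
      exact h2
    · rw [← Scheme.Hom.comp_appTop, ← Scheme.Hom.comp_appTop, hm, pullback.lift_snd]
  have : IsIso m.appTop := h3.isIso_inr_of_isIso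
  exact ConcreteCategory.bijective_of_isIso m.appTop
end

noncomputable section

/-! ### Points of the multiplicative group -/

open Limits

theorem structureRingHom_comp {R : CommRingCat.{u}} {X Y : Scheme.{u}} (f : X ⟶ Y)
    (π : Y ⟶ Spec R) : structureRingHom (f ≫ π) = structureRingHom π ≫ f.appTop := by
  simp [structureRingHom]

theorem structureRingHom_comp_SpecMap {R R' : CommRingCat.{u}} {X : Scheme.{u}} (π : X ⟶ Spec R)
    (g : R' ⟶ R) : structureRingHom (π ≫ Spec.map g) = g ≫ structureRingHom π := by
  simp [structureRingHom, Scheme.ΓSpecIso_inv_naturality_assoc]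

/-- Morphisms to an affine scheme are ring homomorphisms to the global sections. -/
def structureRingHomEquiv (R : CommRingCat.{u}) (X : Scheme.{u}) :
    (X ⟶ Spec R) ≃ (R ⟶ Γ(X, ⊤)) where
  toFun := structureRingHom
  invFun g := X.toSpecΓ ≫ Spec.map g
  left_inv π := by
    change X.toSpecΓ ≫ Spec.map ((Scheme.ΓSpecIso R).inv ≫ π.appTop) = π
    rw [Spec.map_comp, ← Category.assoc, ← Scheme.toSpecΓ_naturality,
      Category.assoc]
    simp
  right_inv g := by
    rw [structureRingHom_comp_SpecMap]
    simp [structureRingHom]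

/-- The tautological unit of the Laurent polynomial ring. -/
def laurentUnit (A : Type u) [CommRing A] : A[T;T⁻¹]ˣ :=
  ⟨.T 1, .T (-1), by rw [← LaurentPolynomial.T_add, add_neg_cancel, LaurentPolynomial.T_zero],
    by rw [← LaurentPolynomial.T_add, neg_add_cancel, LaurentPolynomial.T_zero]⟩

theorem laurentPolynomial_ringHom_ext {A B : Type u} [CommRing A] [CommRing B]
    {f g : A[T;T⁻¹] →+* B} (hC : f.comp LaurentPolynomial.C = g.comp LaurentPolynomial.C)
    (hT : Units.map (f : A[T;T⁻¹] →* B) (laurentUnit A) =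
      Units.map (g : A[T;T⁻¹] →* B) (laurentUnit A)) : f = g := by
  have hT' : f (.T 1) = g (.T 1) := congr_arg Units.val hT
  have hT'' : f (.T (-1)) = g (.T (-1)) := congr_arg Units.inv hT
  refine RingHom.ext fun x ↦ ?_
  induction x using LaurentPolynomial.induction_on with
  | h_C a => exact RingHom.congr_fun hC a
  | h_add hx hy => rw [map_add, map_add, hx, hy]
  | h_C_mul_T n a h =>
    rw [LaurentPolynomial.T_add, ← mul_assoc, map_mul, map_mul g, h, hT']
  | h_C_mul_T_Z n a h =>
    rw [sub_eq_add_neg, LaurentPolynomial.T_add, ← mul_assoc, map_mul, map_mul g, h, hT'']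

/-- The morphism of schemes underlying a point of the multiplicative group. -/
def multiplicativeGroupPoint {A : CommRingCat.{u}} {Z : Over (Spec A)}
    (f : Z ⟶ (multiplicativeGroup A).X) : Z.left ⟶ Spec (.of A[T;T⁻¹]) :=
  f.left

theorem multiplicativeGroupPoint_comp_SpecMap {A : CommRingCat.{u}} {Z : Over (Spec A)}
    (f : Z ⟶ (multiplicativeGroup A).X) :
    multiplicativeGroupPoint f ≫
      Spec.map (CommRingCat.ofHom (algebraMap A A[T;T⁻¹])) = Z.hom :=
  Over.w f

theorem multiplicativeGroupPoint_comp {A : CommRingCat.{u}} {Z Z' : Over (Spec A)} (g : Z' ⟶ Z)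
    (f : Z ⟶ (multiplicativeGroup A).X) :
    multiplicativeGroupPoint (g ≫ f) = g.left ≫ multiplicativeGroupPoint f := rfl

/-- The pair of points of the multiplicative group as a point of the spectrum of the tensor
product. -/
def multiplicativeGroupPair {A : CommRingCat.{u}} {Z : Over (Spec A)}
    (f g : Z ⟶ (multiplicativeGroup A).X) :
    Z.left ⟶ Spec (.of (A[T;T⁻¹] ⊗[A] A[T;T⁻¹])) :=
  pullback.lift (f := Spec.map (CommRingCat.ofHom (algebraMap A A[T;T⁻¹])))
    (g := Spec.map (CommRingCat.ofHom (algebraMap A A[T;T⁻¹]))) (multiplicativeGroupPoint f) (multiplicativeGroupPoint g)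
    ((multiplicativeGroupPoint_comp_SpecMap f).trans
      (multiplicativeGroupPoint_comp_SpecMap g).symm) ≫ (pullbackSpecIso A A[T;T⁻¹] A[T;T⁻¹]).hom

theorem multiplicativeGroupPoint_mul {A : CommRingCat.{u}} {Z : Over (Spec A)}
    (f g : Z ⟶ (multiplicativeGroup A).X) :
    multiplicativeGroupPoint (CartesianMonoidalCategory.lift f g ≫ MonObj.mul) =
      multiplicativeGroupPair f g ≫ Spec.map (CommRingCat.ofHom (R := A[T;T⁻¹])
        (S := A[T;T⁻¹] ⊗[A] A[T;T⁻¹]) (Bialgebra.comulAlgHom A A[T;T⁻¹]).toRingHom) :=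
  (Category.assoc _ _ _).symm

theorem multiplicativeGroupPair_fst {A : CommRingCat.{u}} {Z : Over (Spec A)}
    (f g : Z ⟶ (multiplicativeGroup A).X) :
    multiplicativeGroupPair f g ≫
      Spec.map (CommRingCat.ofHom Algebra.TensorProduct.includeLeftRingHom) =
        multiplicativeGroupPoint f := by
  rw [multiplicativeGroupPair, Category.assoc, pullbackSpecIso_hom_fst, pullback.lift_fst]

theorem multiplicativeGroupPair_snd {A : CommRingCat.{u}} {Z : Over (Spec A)}
    (f g : Z ⟶ (multiplicativeGroup A).X) :
    multiplicativeGroupPair f g ≫ Spec.map (CommRingCat.ofHom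
      (RingHomClass.toRingHom Algebra.TensorProduct.includeRight)) =
        multiplicativeGroupPoint g := by
  rw [multiplicativeGroupPair, Category.assoc, pullbackSpecIso_hom_snd, pullback.lift_snd]

/-- The unit attached to a point of the multiplicative group. -/
def multiplicativeGroupUnit {A : CommRingCat.{u}} {Z : Over (Spec A)}
    (f : Z ⟶ (multiplicativeGroup A).X) : Γ(Z.left, ⊤)ˣ :=
  Units.map ((structureRingHom (multiplicativeGroupPoint f)).hom : A[T;T⁻¹] →* Γ(Z.left, ⊤))
    (laurentUnit A)

theorem multiplicativeGroupUnit_comp {A : CommRingCat.{u}} {Z Z' : Over (Spec A)} (g : Z' ⟶ Z)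
    (f : Z ⟶ (multiplicativeGroup A).X) :
    multiplicativeGroupUnit (g ≫ f) = Units.map g.left.appTop.hom (multiplicativeGroupUnit f) := by
  refine Units.ext ?_
  change structureRingHom (multiplicativeGroupPoint (g ≫ f)) (.T 1) = _
  rw [multiplicativeGroupPoint_comp, structureRingHom_comp]
  rfl

/-- A ring map out of `A[T;T⁻¹]` is determined by the constants and by `T`; lying over `Spec A`
fixes the constants. -/
theorem multiplicativeGroupUnit_injective {A : CommRingCat.{u}} {Z : Over (Spec A)} :
    Function.Injective (multiplicativeGroupUnit (Z := Z)) := by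
  intro f g h
  refine Over.OverMorphism.ext ((structureRingHomEquiv (.of A[T;T⁻¹]) Z.left).injective ?_)
  refine CommRingCat.hom_ext (laurentPolynomial_ringHom_ext ?_ h)
  have key (f : Z ⟶ (multiplicativeGroup A).X) :
      CommRingCat.ofHom (algebraMap A A[T;T⁻¹]) ≫ structureRingHom (multiplicativeGroupPoint f) =
        structureRingHom Z.hom := by
    rw [← structureRingHom_comp_SpecMap, multiplicativeGroupPoint_comp_SpecMap]
  exact congr_arg CommRingCat.Hom.hom ((key f).trans (key g).symm)

theorem multiplicativeGroupUnit_surjective {A : CommRingCat.{u}} {Z : Over (Spec A)} :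
    Function.Surjective (multiplicativeGroupUnit (Z := Z)) := by
  intro u
  let φ : CommRingCat.of A[T;T⁻¹] ⟶ Γ(Z.left, ⊤) :=
    CommRingCat.ofHom (LaurentPolynomial.eval₂ (structureRingHom Z.hom).hom u)
  have hφ : CommRingCat.ofHom LaurentPolynomial.C ≫ φ = structureRingHom Z.hom := by
    ext a
    exact LaurentPolynomial.eval₂_C _ _ a
  let f : Z ⟶ (multiplicativeGroup A).X :=
    Over.homMk (U := Z) ((structureRingHomEquiv (.of A[T;T⁻¹]) Z.left).symm φ) (by
      refine (structureRingHomEquiv A Z.left).injective ?_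
      refine (structureRingHom_comp_SpecMap _ (CommRingCat.ofHom LaurentPolynomial.C)).trans ?_
      exact (congr_arg (_ ≫ ·) ((structureRingHomEquiv _ _).apply_symm_apply φ)).trans hφ)
  refine ⟨f, Units.ext ?_⟩
  have hf : structureRingHom (multiplicativeGroupPoint f) = φ :=
    (structureRingHomEquiv _ _).apply_symm_apply φ
  change structureRingHom (multiplicativeGroupPoint f) (.T 1) = _
  rw [hf]
  exact (LaurentPolynomial.eval₂_T _ _ 1).trans (by simp)

/-- The comultiplication sends `T` to `T ⊗ T = (T ⊗ 1) * (1 ⊗ T)`, and the two factors pull back to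
the units of `f` and `g`. -/
theorem multiplicativeGroupUnit_mul {A : CommRingCat.{u}} {Z : Over (Spec A)}
    (f g : Z ⟶ (multiplicativeGroup A).X) :
    multiplicativeGroupUnit (CartesianMonoidalCategory.lift f g ≫ MonObj.mul) =
      multiplicativeGroupUnit f * multiplicativeGroupUnit g := by
  refine Units.ext ?_
  change structureRingHom (multiplicativeGroupPoint (CartesianMonoidalCategory.lift f g ≫
      MonObj.mul)) (.T 1) = structureRingHom (multiplicativeGroupPoint f) (.T 1) *
        structureRingHom (multiplicativeGroupPoint g) (.T 1)
  rw [multiplicativeGroupPoint_mul, ← multiplicativeGroupPair_fst f g,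
    ← multiplicativeGroupPair_snd f g, structureRingHom_comp_SpecMap, structureRingHom_comp_SpecMap,
    structureRingHom_comp_SpecMap]
  set h := (structureRingHom (multiplicativeGroupPair f g)).hom
  change h (Coalgebra.comul (R := A) (.T 1 : A[T;T⁻¹])) =
    h ((.T 1 : A[T;T⁻¹]) ⊗ₜ[A] (1 : A[T;T⁻¹])) * h ((1 : A[T;T⁻¹]) ⊗ₜ[A] (.T 1 : A[T;T⁻¹]))
  rw [← map_mul, LaurentPolynomial.comul_T, Algebra.TensorProduct.tmul_mul_tmul, one_mul, mul_one]

/-- The points of the multiplicative group are the units of the global sections. -/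
def multiplicativeGroupEquiv {A : CommRingCat.{u}} (Z : Over (Spec A)) :
    (yonedaGrp.obj (multiplicativeGroup A)).obj (op Z) ≃* Γ(Z.left, ⊤)ˣ :=
  { Equiv.ofBijective (multiplicativeGroupUnit (Z := Z))
      ⟨multiplicativeGroupUnit_injective, multiplicativeGroupUnit_surjective⟩ with
    map_mul' := multiplicativeGroupUnit_mul }
end

noncomputable section

/-! ### The direct image of the Milnor K-theory sheaf -/

theorem toSpecΓ_comp_specGlobalSections {X : Scheme.{u}} {R : CommRingCat.{u}} (π : X ⟶ Spec R) :
    X.toSpecΓ ≫ specGlobalSections π = π :=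
  (structureRingHomEquiv R X).left_inv π

theorem flat_over_field {k : Type u} [Field k] (T : Over (Spec (CommRingCat.of k))) :
    Flat T.hom := by
  have : Subsingleton (Spec (CommRingCat.of k)) := inferInstanceAs (Subsingleton (PrimeSpectrum k))
  infer_instance

/-- The map `Γ(T ×_k S, 𝒪)ˣ ⟶ Γ(T ×_k X, 𝒪)ˣ`, where `S = Spec Γ(X, 𝒪)`, as an isomorphism. -/
def unitsPullbackEquiv {k : Type u} [Field k] {X : Scheme.{u}}
    (π : X ⟶ Spec (CommRingCat.of k)) [QuasiCompact π] [QuasiSeparated π]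
    (T : (Over (Spec (CommRingCat.of k)))ᵒᵖ) :
    ((pullbackSections (specGlobalSections π)).obj T)ˣ ≃* ((pullbackSections π).obj T)ˣ :=
  Units.mapEquiv (RingEquiv.ofBijective ((pullbackSectionsMap π (specGlobalSections π) X.toSpecΓ
    (toSpecΓ_comp_specGlobalSections π)).app T).hom (by
      have : IsIso X.toSpecΓ.appTop := by
        rw [Scheme.toSpecΓ_appTop]
        infer_instance
      have : QuasiCompact (specGlobalSections π) := by
        unfold specGlobalSections
        infer_instance
      have : QuasiSeparated (specGlobalSections π) := by
        unfold specGlobalSections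
        infer_instance
      exact bijective_pullbackSectionsMap _ _ _ _ flat_over_field T.unop)).toMulEquiv

theorem unitsPullbackEquiv_naturality {k : Type u} [Field k] {X : Scheme.{u}}
    (π : X ⟶ Spec (CommRingCat.of k)) [QuasiCompact π] [QuasiSeparated π]
    {T T' : (Over (Spec (CommRingCat.of k)))ᵒᵖ} (f : T ⟶ T')
    (x : ((pullbackSections (specGlobalSections π)).obj T)ˣ) :
    Units.map ((pullbackSections π).map f).hom (unitsPullbackEquiv π T x) =
      unitsPullbackEquiv π T' (Units.map ((pullbackSections (specGlobalSections π)).map f).hom x) :=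
  Units.ext (ConcreteCategory.congr_hom ((pullbackSectionsMap π (specGlobalSections π) X.toSpecΓ
    (toSpecΓ_comp_specGlobalSections π)).naturality f) x.1).symm

/-- The units of `Γ(T ×_Y X, 𝒪)` are the sections of the direct image of the degree one Milnor
K-theory sheaf. -/
def unitsMulEquivBigPushforward {X Y : Scheme.{u}} (π : X ⟶ Y) (T : (Over Y)ᵒᵖ) :
    ((pullbackSections π).obj T)ˣ ≃* (bigPushforward π (milnorKSheaf 1 X)).obj T :=
  unitsMulEquivMilnorKSheaf X (op ((Over.pullback π).obj T.unop))

theorem unitsMulEquivBigPushforward_naturality {X Y : Scheme.{u}} (π : X ⟶ Y)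
    {T T' : (Over Y)ᵒᵖ} (f : T ⟶ T') (u : ((pullbackSections π).obj T)ˣ) :
    (bigPushforward π (milnorKSheaf 1 X)).map f (unitsMulEquivBigPushforward π T u) =
      unitsMulEquivBigPushforward π T' (Units.map ((pullbackSections π).map f).hom u) :=
  unitsMulEquivMilnorKSheaf_naturality X ((Over.pullback π).op.map f) u

/-- The points of the Weil restriction of the multiplicative group as units. -/
def multiplicativeGroupPullbackEquiv {A : CommRingCat.{u}} {Y : Scheme.{u}} (ρ : Spec A ⟶ Y)
    (T : (Over Y)ᵒᵖ) : ((Over.pullback ρ).op ⋙ yonedaGrp.obj (multiplicativeGroup A)).obj T ≃*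
      ((pullbackSections ρ).obj T)ˣ :=
  multiplicativeGroupEquiv ((Over.pullback ρ).obj T.unop)

theorem multiplicativeGroupPullbackEquiv_naturality {A : CommRingCat.{u}} {Y : Scheme.{u}}
    (ρ : Spec A ⟶ Y) {T T' : (Over Y)ᵒᵖ} (f : T ⟶ T')
    (x : ((Over.pullback ρ).op ⋙ yonedaGrp.obj (multiplicativeGroup A)).obj T) :
    Units.map ((pullbackSections ρ).map f).hom (multiplicativeGroupPullbackEquiv ρ T x) =
      multiplicativeGroupPullbackEquiv ρ T'
        (((Over.pullback ρ).op ⋙ yonedaGrp.obj (multiplicativeGroup A)).map f x) :=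
  (multiplicativeGroupUnit_comp ((Over.pullback ρ).map f.unop) x).symm

/-- The points of the Weil restriction of the multiplicative group of `Γ(X, 𝒪)` are the sections of
the direct image of the degree one Milnor K-theory sheaf. -/
def weilRestrictionPointsEquiv {k : Type u} [Field k] {X : Scheme.{u}}
    (π : X ⟶ Spec (CommRingCat.of k)) [QuasiCompact π] [QuasiSeparated π]
    (T : (Over (Spec (CommRingCat.of k)))ᵒᵖ) :
    ((Over.pullback (specGlobalSections π)).op ⋙ yonedaGrp.obj (multiplicativeGroup Γ(X, ⊤))).obj T
      ≃* (bigPushforward π (milnorKSheaf 1 X)).obj T :=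
  (multiplicativeGroupPullbackEquiv (specGlobalSections π) T).trans
    ((unitsPullbackEquiv π T).trans (unitsMulEquivBigPushforward π T))

theorem weilRestrictionPointsEquiv_naturality {k : Type u} [Field k] {X : Scheme.{u}}
    (π : X ⟶ Spec (CommRingCat.of k)) [QuasiCompact π] [QuasiSeparated π]
    {T T' : (Over (Spec (CommRingCat.of k)))ᵒᵖ} (f : T ⟶ T')
    (x : ((Over.pullback (specGlobalSections π)).op ⋙
      yonedaGrp.obj (multiplicativeGroup Γ(X, ⊤))).obj T) :
    (bigPushforward π (milnorKSheaf 1 X)).map f (weilRestrictionPointsEquiv π T x) =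
      weilRestrictionPointsEquiv π T' (((Over.pullback (specGlobalSections π)).op ⋙
        yonedaGrp.obj (multiplicativeGroup Γ(X, ⊤))).map f x) := by
  simp only [weilRestrictionPointsEquiv, MulEquiv.trans_apply]
  rw [unitsMulEquivBigPushforward_naturality, unitsPullbackEquiv_naturality,
    multiplicativeGroupPullbackEquiv_naturality]

theorem Represents.of_mulEquiv {C : Type w} [Category.{v} C] [CartesianMonoidalCategory C]
    {G : Grp C} {F : Cᵒᵖ ⥤ GrpCat.{u}} {F' : Cᵒᵖ ⥤ GrpCat.{u'}} (h : Represents G F)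
    (e : ∀ T, F.obj T ≃* F'.obj T)
    (he : ∀ ⦃T T' : Cᵒᵖ⦄ (f : T ⟶ T') (x : F.obj T), F'.map f (e T x) = e T' (F.map f x)) :
    Represents G F' := by
  obtain ⟨e', he'⟩ := h
  refine ⟨fun T ↦ (e' T).trans (e T), fun T T' f x ↦ ?_⟩
  exact (he f _).trans (congr_arg (e T') (he' f x))
end

noncomputable section

/-! ### The universal unit of a finite free algebra -/

section UniversalUnit

variable {R A ι : Type u} [CommRing R] [CommRing A] [Algebra R A] (b : Module.Basis ι R A)

theorem basis_repr_map {B B' : Type u} [CommRing B] [Algebra R B] [CommRing B'] [Algebra R B']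
    (f : B →ₐ[R] B') (z : B ⊗[R] A) (i : ι) :
    (Algebra.TensorProduct.basis B' b).repr (Algebra.TensorProduct.map f (AlgHom.id R A) z) i =
      f ((Algebra.TensorProduct.basis B b).repr z i) := by
  induction z with
  | zero => simp
  | add x y hx hy => simp [hx, hy]
  | tmul x y => simp [Algebra.TensorProduct.basis_repr_tmul]

variable [Fintype ι]

/-- The linear combination of the basis with the given coefficients. -/
def basisCombination {B : Type u} [CommRing B] [Algebra R B] (p : ι → B) : B ⊗[R] A :=
  ∑ i, p i ⊗ₜ[R] b i

theorem basisCombination_eq {B : Type u} [CommRing B] [Algebra R B] (p : ι → B) :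
    basisCombination b p = (Algebra.TensorProduct.basis B b).equivFun.symm p := by
  simp [basisCombination, Module.Basis.equivFun_symm_apply, TensorProduct.smul_tmul']

theorem map_basisCombination {B B' : Type u} [CommRing B] [Algebra R B] [CommRing B'] [Algebra R B']
    (f : B →ₐ[R] B') (p : ι → B) :
    Algebra.TensorProduct.map f (AlgHom.id R A) (basisCombination b p) =
      basisCombination b (f ∘ p) := by
  simp [basisCombination]

/-- The ideal of the equations of an invertible element and its inverse. -/
def universalUnitIdeal : Ideal (MvPolynomial (ι ⊕ ι) R) :=
  Ideal.span (Set.range ((Algebra.TensorProduct.basis (MvPolynomial (ι ⊕ ι) R) b).repr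
    (basisCombination b (MvPolynomial.X ∘ Sum.inl) * basisCombination b (MvPolynomial.X ∘ Sum.inr)
      - 1)))

theorem universalUnitIdeal_le_ker {B : Type u} [CommRing B] [Algebra R B]
    (f : MvPolynomial (ι ⊕ ι) R →ₐ[R] B) (hf : basisCombination b (f ∘ MvPolynomial.X ∘ Sum.inl) *
      basisCombination b (f ∘ MvPolynomial.X ∘ Sum.inr) = 1) :
    universalUnitIdeal b ≤ RingHom.ker f := by
  refine Ideal.span_le.2 ?_
  rintro _ ⟨i, rfl⟩
  change f _ = 0
  rw [← basis_repr_map, map_sub, map_mul, map_one, map_basisCombination, map_basisCombination, hf,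
    sub_self, map_zero, Finsupp.zero_apply]

theorem basisCombination_universal_mul :
    basisCombination b (Ideal.Quotient.mkₐ R (universalUnitIdeal b) ∘ MvPolynomial.X ∘ Sum.inl) *
      basisCombination b (Ideal.Quotient.mkₐ R (universalUnitIdeal b) ∘ MvPolynomial.X ∘ Sum.inr) =
        1 := by
  rw [← map_basisCombination, ← map_basisCombination, ← map_mul, ← sub_eq_zero,
    ← map_one (Algebra.TensorProduct.map (Ideal.Quotient.mkₐ R (universalUnitIdeal b))
      (AlgHom.id R A)), ← map_sub]
  refine (Algebra.TensorProduct.basis _ b).ext_elem fun i ↦ ?_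
  rw [basis_repr_map, map_zero, Finsupp.zero_apply]
  exact Ideal.Quotient.eq_zero_iff_mem.2 (Ideal.subset_span ⟨i, rfl⟩)

/-- The universal unit of `A`. -/
def universalUnit : ((MvPolynomial (ι ⊕ ι) R ⧸ universalUnitIdeal b) ⊗[R] A)ˣ :=
  ⟨_, _, basisCombination_universal_mul b,
    (mul_comm _ _).trans (basisCombination_universal_mul b)⟩

/-- The two families of variables are the coordinates of a unit and of its inverse, and the ideal
says that their product is `1`. The inverse is unique, so the second family adds no data. -/
theorem bijective_universalUnit (B : Type u) [CommRing B] [Algebra R B] :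
    Function.Bijective fun g : (MvPolynomial (ι ⊕ ι) R ⧸ universalUnitIdeal b) →ₐ[R] B ↦
      Units.map (Algebra.TensorProduct.map g (AlgHom.id R A) : _ →* B ⊗[R] A)
        (universalUnit b) := by
  have hinj : Function.Injective (basisCombination (B := B) b) := by
    rw [funext (basisCombination_eq (B := B) b)]
    exact (Algebra.TensorProduct.basis B b).equivFun.symm.injective
  constructor
  · intro g g' h
    have h1 := congr_arg Units.val h
    have h2 := congr_arg Units.inv h
    change Algebra.TensorProduct.map g (AlgHom.id R A) (basisCombination b _) =
      Algebra.TensorProduct.map g' (AlgHom.id R A) (basisCombination b _) at h1 h2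
    rw [map_basisCombination, map_basisCombination] at h1 h2
    refine Ideal.Quotient.algHom_ext _ (MvPolynomial.algHom_ext fun i ↦ ?_)
    rcases i with i | i
    · exact congr_fun (hinj h1) i
    · exact congr_fun (hinj h2) i
  · intro v
    obtain ⟨p, hp⟩ := (Algebra.TensorProduct.basis B b).equivFun.symm.surjective v.val
    obtain ⟨q, hq⟩ := (Algebra.TensorProduct.basis B b).equivFun.symm.surjective v.inv
    rw [← basisCombination_eq] at hp hq
    have hp' : MvPolynomial.aeval (R := R) (Sum.elim p q) ∘ MvPolynomial.X ∘ Sum.inl = p := by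
      ext i
      simp
    have hq' : MvPolynomial.aeval (R := R) (Sum.elim p q) ∘ MvPolynomial.X ∘ Sum.inr = q := by
      ext i
      simp
    refine ⟨Ideal.Quotient.liftₐ _ (MvPolynomial.aeval (Sum.elim p q))
      (universalUnitIdeal_le_ker b _ ?_), Units.ext ?_⟩
    · rw [hp', hq', hp, hq, v.val_inv]
    · refine Eq.trans ?_ hp
      change Algebra.TensorProduct.map _ (AlgHom.id R A) (basisCombination b _) = _
      rw [map_basisCombination]
      congr 1

end UniversalUnit

/-- The group of units of a finite free algebra is representable. -/
theorem exists_universalUnit (R A : Type u) [CommRing R] [CommRing A] [Algebra R A]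
    [Module.Free R A] [Module.Finite R A] :
    ∃ (C : Type u) (_ : CommRing C) (_ : Algebra R C) (u : (C ⊗[R] A)ˣ),
      ∀ (B : Type u) [CommRing B] [Algebra R B], Function.Bijective fun g : C →ₐ[R] B ↦
        Units.map (Algebra.TensorProduct.map g (AlgHom.id R A) : _ →* B ⊗[R] A) u :=
  ⟨_, _, _, universalUnit (Module.Free.chooseBasis R A), fun B _ _ ↦ bijective_universalUnit _ B⟩
end

noncomputable section

/-! ### Existence of the Weil restriction -/

open Limits

/-- The universal unit is rephrased for arbitrary pushout squares, so that it applies to rings of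
sections on fibre products without choosing tensor products. -/
theorem exists_isPushout_universalUnit {R A : CommRingCat.{u}} (a : R ⟶ A)
    (hfin : a.hom.Finite) (hfree : letI := a.hom.toAlgebra; Module.Free R A) :
    ∃ (C : CommRingCat.{u}) (c : R ⟶ C) (P : CommRingCat.{u}) (p : C ⟶ P) (q : A ⟶ P)
      (h : IsPushout c a p q) (x : Pˣ), ∀ (B : CommRingCat.{u}) (φ : R ⟶ B) (D : CommRingCat.{u})
        (i : B ⟶ D) (j : A ⟶ D) (hD : IsPushout φ a i j),
        Function.Bijective fun g : {g : C ⟶ B // c ≫ g = φ} ↦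
          Units.map (N := D) (h.desc (g.1 ≫ i) j (by rw [← Category.assoc, g.2, hD.w])).hom x := by
  let _ := a.hom.toAlgebra
  have : Module.Finite R A := hfin
  obtain ⟨C, _, _, x, hx⟩ := exists_universalUnit R A
  refine ⟨.of C, CommRingCat.ofHom (algebraMap R C), _, _, _,
    CommRingCat.isPushout_tensorProduct R C A, x, fun B φ D i j hD ↦ ?_⟩
  let _ := φ.hom.toAlgebra
  let e : CommRingCat.of (B ⊗[R] A) ≅ D :=
    (CommRingCat.isPushout_tensorProduct R B A).isoIsPushout _ _ hD
  let m : {g : CommRingCat.of C ⟶ B // CommRingCat.ofHom (algebraMap R C) ≫ g = φ} ≃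
      (C →ₐ[R] B) :=
    { toFun g := ⟨g.1.hom, fun r ↦ ConcreteCategory.congr_hom g.2 r⟩
      invFun g := ⟨CommRingCat.ofHom g, by ext r; exact g.commutes r⟩
      left_inv g := rfl
      right_inv g := rfl }
  refine (congr_arg Function.Bijective ?_).mpr ((Units.mapEquiv
    e.commRingCatIsoToRingEquiv.toMulEquiv).bijective.comp ((hx B).comp m.bijective))
  funext g
  refine Units.ext ?_
  have key : (CommRingCat.isPushout_tensorProduct R C A).desc (g.1 ≫ i) j
      (by rw [← Category.assoc, g.2, hD.w]; rfl) =
        CommRingCat.ofHom (Algebra.TensorProduct.map (m g) (AlgHom.id R A)).toRingHom ≫ e.hom := by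
    refine (CommRingCat.isPushout_tensorProduct R C A).hom_ext ?_ ?_
    · rw [IsPushout.inl_desc]
      have h1 : CommRingCat.ofHom Algebra.TensorProduct.includeLeftRingHom ≫
          CommRingCat.ofHom (Algebra.TensorProduct.map (m g) (AlgHom.id R A)).toRingHom =
          g.1 ≫ CommRingCat.ofHom (S := B ⊗[R] A) Algebra.TensorProduct.includeLeftRingHom := by
        ext y
        exact Algebra.TensorProduct.map_tmul _ _ _ _
      rw [← Category.assoc, h1, Category.assoc]
      exact congr_arg (g.1 ≫ ·) (IsPushout.inl_isoIsPushout_hom _ _ _ hD).symm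
    · rw [IsPushout.inr_desc]
      have h1 : CommRingCat.ofHom Algebra.TensorProduct.includeRight.toRingHom ≫
          CommRingCat.ofHom (Algebra.TensorProduct.map (m g) (AlgHom.id R A)).toRingHom =
          CommRingCat.ofHom (S := B ⊗[R] A) Algebra.TensorProduct.includeRight.toRingHom := by
        ext y
        refine (Algebra.TensorProduct.map_tmul _ _ _ _).trans ?_
        rw [map_one]
        rfl
      rw [← Category.assoc, h1]
      exact (IsPushout.inr_isoIsPushout_hom _ _ _ hD).symm
  exact ConcreteCategory.congr_hom key x.1

/-- The functor of units of `T ↦ Γ(T ×_Y S, 𝒪)` is representable if it is represented on affine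
schemes by a universal element. -/
theorem bijective_unitsPullback_of_affine {S Y : Scheme.{u}} (ρ : S ⟶ Y) (G : Over Y)
    (x : ((pullbackSections ρ).obj (op G))ˣ)
    (h : ∀ T : Over Y, IsAffine T.left → Function.Bijective fun f : T ⟶ G ↦
      Units.map (N := (pullbackSections ρ).obj (op T)) ((pullbackSections ρ).map f.op).hom x) (T : Over Y) :
    Function.Bijective fun f : T ⟶ G ↦ Units.map (N := (pullbackSections ρ).obj (op T)) ((pullbackSections ρ).map f.op).hom x := by
  -- By Yoneda, `x` is a morphism of sheaves from `yoneda.obj G` to the units, so bijectivity may be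
  -- checked on affine schemes.
  have key (T : Over Y) : ⇑((yonedaEquiv (F := unitsPresheaf (pullbackSections ρ))).symm x |>.app
      (op T)) = fun f : T ⟶ G ↦ Units.map (N := (pullbackSections ρ).obj (op T)) ((pullbackSections ρ).map f.op).hom x := rfl
  rw [← key]
  exact Presieve.IsSheaf.bijective_of_covers
    (GrothendieckTopology.Subcanonical.isSheaf_of_isRepresentable
      (J := Scheme.zariskiTopology.over Y) (yoneda.obj G))
    (isSheaf_unitsPresheaf _ _ (isSheaf_pullbackSections_forget ρ)) _ (fun T ↦ IsAffine T.left)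
    (fun T hT ↦ by rw [key]; exact h T hT) exists_affine_presieve_generate_mem T

/-- Morphisms over `Spec R` to the spectrum of an `R`-algebra. -/
def overSpecHomEquiv {R C : CommRingCat.{u}} (c : R ⟶ C) (T : Over (Spec R)) :
    (T ⟶ Over.mk (Spec.map c)) ≃ {g : C ⟶ Γ(T.left, ⊤) // c ≫ g = structureRingHom T.hom} where
  toFun f := ⟨structureRingHom (R := C) f.left, by
    rw [← structureRingHom_comp_SpecMap]
    exact congr_arg structureRingHom (Over.w f)⟩
  invFun g := Over.homMk ((structureRingHomEquiv C T.left).symm g.1)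
    ((structureRingHomEquiv R T.left).injective ((structureRingHom_comp_SpecMap _ _).trans
      ((congr_arg (c ≫ ·) ((structureRingHomEquiv C T.left).apply_symm_apply g.1)).trans g.2)))
  left_inv f := Over.OverMorphism.ext ((structureRingHomEquiv C T.left).symm_apply_apply f.left)
  right_inv g := Subtype.ext ((structureRingHomEquiv C T.left).apply_symm_apply g.1)

theorem exists_universal_unitsPullback {R : CommRingCat.{u}} {S : Scheme.{u}} (ρ : S ⟶ Spec R)
    [QuasiCompact ρ] [QuasiSeparated ρ] (hR : ∀ T : Over (Spec R), Flat T.hom)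
    (hfin : (structureRingHom ρ).hom.Finite)
    (hfree : letI := (structureRingHom ρ).hom.toAlgebra; Module.Free R Γ(S, ⊤)) :
    ∃ (G : Over (Spec R)) (x : ((pullbackSections ρ).obj (op G))ˣ), ∀ T : Over (Spec R),
      Function.Bijective fun f : T ⟶ G ↦ Units.map (N := (pullbackSections ρ).obj (op T)) ((pullbackSections ρ).map f.op).hom x := by
  obtain ⟨C, c, P, p, q, h, x, hx⟩ := exists_isPushout_universalUnit (structureRingHom ρ) hfin hfree
  have hw (T : Over (Spec R)) : structureRingHom T.hom ≫ (pullback.fst T.hom ρ).appTop =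
      structureRingHom ρ ≫ (pullback.snd T.hom ρ).appTop := by
    rw [← structureRingHom_comp, ← structureRingHom_comp, pullback.condition]
  let G : Over (Spec R) := Over.mk (Spec.map c)
  have hG : c ≫ (Scheme.ΓSpecIso C).inv ≫ (pullback.fst G.hom ρ).appTop =
      structureRingHom ρ ≫ (pullback.snd G.hom ρ).appTop := by
    rw [← hw, ← Category.assoc, Scheme.ΓSpecIso_inv_naturality]
    rfl
  -- `d` need not be known to be an isomorphism: universality is tested only after composing with
  -- the map to sections over each affine `T`.
  let d : P ⟶ (pullbackSections ρ).obj (op G) := h.desc _ _ hG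
  refine ⟨G, Units.map d.hom x, bijective_unitsPullback_of_affine _ _ _ fun T hT ↦ ?_⟩
  have := hR T
  have hD : IsPushout (structureRingHom T.hom) (structureRingHom ρ)
      (pullback.fst T.hom ρ).appTop (pullback.snd T.hom ρ).appTop :=
    (isPushout_appTop_of_flat ρ T.hom).flip.of_iso (Scheme.ΓSpecIso R) (Iso.refl _) (Iso.refl _)
      (Iso.refl _) (by simp [structureRingHom]) (by simp [structureRingHom]) (by simp) (by simp)
  refine (congr_arg Function.Bijective ?_).mpr
    ((hx _ _ _ _ _ hD).comp (overSpecHomEquiv c T).bijective)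
  funext f
  have key : h.desc _ _ hG ≫ (pullback.lift (f := G.hom) (pullback.fst T.hom ρ ≫ f.left)
        (pullback.snd T.hom ρ) (by rw [Category.assoc, Over.w f, pullback.condition])).appTop =
      h.desc ((overSpecHomEquiv c T f).1 ≫ (pullback.fst T.hom ρ).appTop)
        (pullback.snd T.hom ρ).appTop
        (by rw [← Category.assoc, (overSpecHomEquiv c T f).2, hD.w]) := by
    refine h.hom_ext ?_ ?_
    · rw [IsPushout.inl_desc, IsPushout.inl_desc_assoc, Category.assoc,
        ← Scheme.Hom.comp_appTop, pullback.lift_fst, Scheme.Hom.comp_appTop]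
      exact (Category.assoc _ _ _).symm
    · rw [IsPushout.inr_desc, IsPushout.inr_desc_assoc, ← Scheme.Hom.comp_appTop,
        pullback.lift_snd]
  exact Units.ext (ConcreteCategory.congr_hom key x.1)

/-- The Weil restriction of the multiplicative group along a finite free morphism exists. -/
theorem exists_isWeilRestriction {R A : CommRingCat.{u}} (ρ : Spec A ⟶ Spec R)
    (hR : ∀ T : Over (Spec R), Flat T.hom) (hfin : (structureRingHom ρ).hom.Finite)
    (hfree : letI := (structureRingHom ρ).hom.toAlgebra; Module.Free R Γ(Spec A, ⊤)) :
    ∃ G : Grp (Over (Spec R)), IsWeilRestriction ρ (multiplicativeGroup A) G := by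
  obtain ⟨G, x, hx⟩ := exists_universal_unitsPullback ρ hR hfin hfree
  let F : (Over (Spec R))ᵒᵖ ⥤ GrpCat.{u} :=
    (Over.pullback ρ).op ⋙ yonedaGrp.obj (multiplicativeGroup A)
  let e (T : (Over (Spec R))ᵒᵖ) : F.obj T ≃* ((pullbackSections ρ).obj T)ˣ :=
    multiplicativeGroupPullbackEquiv ρ T
  let α : (F ⋙ forget GrpCat).RepresentableBy G :=
    { homEquiv {T} := (Equiv.ofBijective _ (hx T)).trans (e (op T)).symm.toEquiv
      homEquiv_comp {T T'} f g := by
        refine (e _).injective (((e _).apply_symm_apply _).trans ?_)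
        refine Eq.trans ?_ (multiplicativeGroupPullbackEquiv_naturality ρ f.op _)
        refine Eq.trans ?_ (congr_arg _ ((e _).apply_symm_apply _).symm)
        refine Units.ext ?_
        change (pullbackSections ρ).map (g.op ≫ f.op) x.1 = _
        rw [Functor.map_comp]
        rfl }
  -- `G` represents the underlying set-valued functor; its group law is transported from `F` by
  -- Yoneda.
  let _ := GrpObj.ofRepresentableBy G F α
  let i := yonedaGrpObjIsoOfRepresentableBy G F α
  exact ⟨⟨G⟩, fun T ↦ (i.app T).groupIsoToMulEquiv, fun T T' f y ↦
    (ConcreteCategory.congr_hom (i.hom.naturality f) y).symm⟩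
end

/-! ### The main theorem -/

noncomputable section

theorem finite_structureRingHom_specGlobalSections {k : Type u} [Field k] {X : Scheme.{u}}
    (π : X ⟶ Spec (CommRingCat.of k)) [UniversallyClosed π] [LocallyOfFiniteType π] :
    (structureRingHom (specGlobalSections π)).hom.Finite := by
  have h : structureRingHom (specGlobalSections π) =
      structureRingHom π ≫ (Scheme.ΓSpecIso Γ(X, ⊤)).inv :=
    (Scheme.ΓSpecIso_inv_naturality _).symm
  rw [h, CommRingCat.hom_comp]
  exact (RingHom.Finite.of_surjective _
    (ConcreteCategory.bijective_of_isIso (Scheme.ΓSpecIso Γ(X, ⊤)).inv).2).comp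
      (finite_structureRingHom π)
end
theorem mainTheorem8 (k : Type u) [Field k] (X : Scheme.{u})
    (π : X ⟶ Spec (CommRingCat.of k)) [IsProper π] :
    (∃ R : Grp (Over (Spec (CommRingCat.of k))),
      IsWeilRestriction (specGlobalSections π) (multiplicativeGroup Γ(X, ⊤)) R) ∧
    ∀ R : Grp (Over (Spec (CommRingCat.of k))),
      IsWeilRestriction (specGlobalSections π) (multiplicativeGroup Γ(X, ⊤)) R →
        Represents R (bigPushforward π (milnorKSheaf 1 X)) := by
  -- Any Weil restriction represents the direct image, since the two functors are isomorphic. Only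
  -- existence uses the finiteness of `A`; freeness is automatic over a field.
  refine ⟨?_, fun R hR ↦ Represents.of_mulEquiv hR (weilRestrictionPointsEquiv π)
    fun _ _ ↦ weilRestrictionPointsEquiv_naturality π⟩
  refine exists_isWeilRestriction _ flat_over_field
    (finite_structureRingHom_specGlobalSections π) ?_
  let _ : Module k Γ(Spec Γ(X, ⊤), ⊤) :=
    (structureRingHom (specGlobalSections π)).hom.toAlgebra.toModule
  exact Module.Free.of_divisionRing k Γ(Spec Γ(X, ⊤), ⊤)
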